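/- Let $k$ be an algebraically closed field of characteristic zero. A fusion category over $k$ is a $k$-linear semisimple rigid tensor category with finitely many isomorphism classes of simple objects, finite-dimensional spaces of morphisms and simple unit object $\mathbf 1$. A simple object $X$ is invertible if $X\otimes X^*\cong\mathbf 1$; a fusion category is pointed if all its simple objects are invertible, and its rank is the number of isomorphism classes of its simple objects. A fusion category $\mathcal C$ is an extension of a fusion category $\mathcal D$ if, for some finite group $G$, there is a decomposition $\mathcal C=\bigoplus_{g\in G}\mathcal C_g$ into nonzero full abelian subcategories with $\mathcal C_g\otimes\mathcal C_h\subseteq\mathcal C_{gh}$ for all $g,h\in G$, whose trivial component $\mathcal C_e$ is equivalent to $\mathcal D$ as a fusion category. Let $\operatorname{FPdim}\colon K(\mathcal C)\to\mathbb R$ be the unique ring homomorphism on the Grothendieck ring with $\operatorname{FPdim}(X)\ge 1$ for every nonzero object $X$, and let $\operatorname{cd}(\mathcal C)$ be the set of the numbers $\operatorname{FPdim}(X)$ for $X$ a simple object of $\mathcal C$. Let $\mathcal C$ be a non-pointed fusion category over $k$. Then $\mathcal C$ is an extension of a pointed fusion category of rank $2$ if and only if $\operatorname{cd}(\mathcal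 C)=\{1,\sqrt 2\}$. -/

import Mathlib

open CategoryTheory CategoryTheory.Limits CategoryTheory.MonoidalCategory

universe w v u

namespace FusionCat

attribute [local instance] Abelian.hasFiniteBiproducts

/-- The set of isomorphism classes of simple objects. -/
def Irr (C : Type u) [Category.{v} C] [HasZeroMorphisms C] :
    Set (Quotient (isIsomorphicSetoid C)) :=
  {q | ∃ X : C, Simple X ∧ Quotient.mk (isIsomorphicSetoid C) X = q}

/-- A fusion category over the field `k`: a `k`-linear abelian monoidal category, with tensor
product bilinear on morphisms, which is semisimple and rigid, has finitely many isomorphism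
classes of simple objects and finite-dimensional spaces of morphisms, and whose unit object is
simple. The data (abelian, linear, monoidal) are the instance arguments. -/
class IsFusionCategory (k : Type w) [Field k] (C : Type u) [Category.{v} C] [Abelian C]
    [Linear k C] [MonoidalCategory C] [MonoidalPreadditive C] [MonoidalLinear k C] : Prop where
  /-- every object is a finite direct sum of simple objects -/
  semisimple : ∀ X : C, ∃ (n : ℕ) (S : Fin n → C),
    (∀ i, Simple (S i)) ∧ Nonempty (X ≅ ⨁ S)
  /-- every object has a left dual and a right dual -/
  rigid : Nonempty (RigidCategory C)
  /-- finitely many isomorphism classes of simple objects -/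
  finite_simples : (Irr C).Finite
  finite_hom : ∀ X Y : C, FiniteDimensional k (X ⟶ Y)
  simple_unit : Simple (𝟙_ C)

/-- The rank: the number of isomorphism classes of simple objects. -/
noncomputable def rank (C : Type u) [Category.{v} C] [HasZeroMorphisms C] : ℕ :=
  (Irr C).ncard

/-- `X` is invertible: `X ⊗ X* ≅ 𝟙` for a dual `X*` of `X` (duals are unique up to
isomorphism, so the choice of the dual does not matter). -/
def IsInvertible {C : Type u} [Category.{v} C] [MonoidalCategory C] (X : C) : Prop :=
  ∃ Y : C, Nonempty (ExactPairing X Y) ∧ Nonempty (X ⊗ Y ≅ 𝟙_ C)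

/-- A category is pointed if every simple object is invertible. -/
def IsPointed (C : Type u) [Category.{v} C] [HasZeroMorphisms C] [MonoidalCategory C] : Prop :=
  ∀ X : C, Simple X → IsInvertible X

section Dimension

variable {C : Type u} [Category.{v} C] [Abelian C] [MonoidalCategory C]

/-- `d` is the function on objects induced by a (unital) ring homomorphism from the Grothendieck
ring `K(C)` to `ℝ` with value at least `1` on every nonzero object. As `C` is semisimple, `K(C)`
is generated by the isomorphism classes `[X]` with relations `[X ⊕ Y] = [X] + [Y]`, and its
product is `[X] [Y] = [X ⊗ Y]`. On a fusion category there is exactly one such function. -/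
structure IsFPDimension (d : C → ℝ) : Prop where
  iso : ∀ {X Y : C}, (X ≅ Y) → d X = d Y
  add : ∀ X Y : C, d (X ⊞ Y) = d X + d Y
  unit : d (𝟙_ C) = 1
  mul : ∀ X Y : C, d (X ⊗ Y) = d X * d Y
  one_le : ∀ X : C, ¬ IsZero X → 1 ≤ d X

open Classical in
/-- The Frobenius-Perron dimension of an object: the value of the unique function satisfying
`IsFPDimension` (it exists on every fusion category; the value `0` is a placeholder elsewhere). -/
noncomputable def FPdim (X : C) : ℝ :=
  if h : ∃ d : C → ℝ, IsFPDimension d then h.choose X else 0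

variable (C) in
/-- `cd(C)`: the set of Frobenius-Perron dimensions of the simple objects. -/
noncomputable def cd : Set ℝ := {x | ∃ X : C, Simple X ∧ FPdim X = x}

end Dimension

/-- A faithful grading of `C` by the finite group `G`: a decomposition of `C` as a direct sum
`⨁ g, C_g` of nonzero full subcategories, closed under isomorphism, with `C_g ⊗ C_h ⊆ C_{gh}`.
It follows from `exists_decomp` and `hom_eq_zero` that each `C_g` is closed under finite direct
sums, subobjects and quotients, so that it is an abelian subcategory. -/
structure FaithfulGrading (C : Type u) [Category.{v} C] [Abelian C] [MonoidalCategory C]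
    (G : Type) [Group G] [Finite G] where
  /-- the full subcategory `C_g` -/
  comp : G → ObjectProperty C
  comp_iso : ∀ (g : G) {X Y : C}, (X ≅ Y) → comp g X → comp g Y
  /-- every object is a direct sum of objects of the components -/
  exists_decomp : ∀ X : C, ∃ f : G → C, (∀ g, comp g (f g)) ∧ Nonempty (X ≅ ⨁ f)
  /-- there are no nonzero morphisms between different components -/
  hom_eq_zero : ∀ {g h : G}, g ≠ h → ∀ {X Y : C}, comp g X → comp h Y → ∀ f : X ⟶ Y, f = 0
  tensor_mem : ∀ {g h : G} {X Y : C}, comp g X → comp h Y → comp (g * h) (X ⊗ Y)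
  /-- the unit lies in the trivial component (automatic when the unit is simple) -/
  unit_mem : comp 1 (𝟙_ C)
  /-- every component is nonzero -/
  faithful : ∀ g : G, ∃ X : C, comp g X ∧ ¬ IsZero X

namespace FaithfulGrading

variable {C : Type u} [Category.{v} C] [Abelian C] [MonoidalCategory C]
  {G : Type} [Group G] [Finite G]

/-- The trivial component `C_e`, as a property of objects. -/
def trivialProp (𝒢 : FaithfulGrading C G) : ObjectProperty C := 𝒢.comp 1

instance (𝒢 : FaithfulGrading C G) : 𝒢.trivialProp.IsMonoidal where
  prop_unit := 𝒢.unit_mem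
  prop_tensor X Y hX hY := by
    have h := 𝒢.tensor_mem (g := 1) (h := 1) hX hY
    rwa [mul_one] at h

/-- The trivial component `C_e`, a full monoidal subcategory of `C`. -/
abbrev TrivialComponent (𝒢 : FaithfulGrading C G) : Type u := 𝒢.trivialProp.FullSubcategory

end FaithfulGrading

/-- `C` and `D` are equivalent as `k`-linear monoidal categories. -/
def MonoidalLinearEquivalent (k : Type w) [Field k] (C : Type u) [Category.{v} C]
    [Preadditive C] [Linear k C] [MonoidalCategory C] (D : Type u) [Category.{v} D]
    [Preadditive D] [Linear k D] [MonoidalCategory D] : Prop :=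
  ∃ F : C ⥤ D, F.IsEquivalence ∧ F.Additive ∧ F.Linear k ∧ Nonempty F.Monoidal

/-- `C` is an extension of `D`: for some finite group `G`, it has a faithful `G`-grading whose
trivial component is equivalent to `D`. -/
def IsExtensionOf (k : Type w) [Field k] (C : Type u) [Category.{v} C]
    [Abelian C] [Linear k C] [MonoidalCategory C] (D : Type u) [Category.{v} D]
    [Abelian D] [Linear k D] [MonoidalCategory D] : Prop :=
  ∃ (G : Type) (_ : Group G) (_ : Finite G) (𝒢 : FaithfulGrading C G),
    MonoidalLinearEquivalent k 𝒢.TrivialComponent D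

/-- `C` is an extension of some pointed fusion category of rank 2. -/
def IsExtensionOfRankTwoPointed (k : Type w) [Field k] (C : Type u) [Category.{v} C]
    [Abelian C] [Linear k C] [MonoidalCategory C] : Prop :=
  ∃ (D : Type u) (_ : Category.{v} D) (_ : Abelian D) (_ : Linear k D)
    (_ : MonoidalCategory D) (_ : MonoidalPreadditive D) (_ : MonoidalLinear k D),
    IsFusionCategory k D ∧ IsPointed D ∧ rank D = 2 ∧ IsExtensionOf k C D

end FusionCat

/-- The combinatorial data of the Grothendieck semiring of a fusion category: the simple elements,
the dimensions of the spaces of morphisms, and the existence of duals. -/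
structure FusionData (M : Type*) [Semiring M] where
  /-- the classes of the simple objects -/
  simple : Set M
  /-- the dimension of the space of morphisms -/
  hom : M → M → ℕ
  finite : simple.Finite
  hom_add_left : ∀ a b c, hom (a + b) c = hom a c + hom b c
  hom_add_right : ∀ a b c, hom a (b + c) = hom a b + hom a c
  hom_self : ∀ s ∈ simple, hom s s = 1
  hom_ne : ∀ s ∈ simple, ∀ t ∈ simple, s ≠ t → hom s t = 0
  one_mem : 1 ∈ simple
  induction : ∀ P : M → Prop, P 0 → (∀ s ∈ simple, ∀ x, P x → P (s + x)) → ∀ x, P x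
  exists_dual : ∀ s ∈ simple, ∃ s', ∀ a b,
    hom (a * s) b = hom a (b * s') ∧ hom (s' * a) b = hom a (s * b)

namespace FusionData

variable {M : Type*} [Semiring M] (F : FusionData M)

lemma hom_zero_left (b : M) : F.hom 0 b = 0 := by
  have := F.hom_add_left 0 0 b
  rw [add_zero] at this
  omega

lemma hom_zero_right (b : M) : F.hom b 0 = 0 := by
  have := F.hom_add_right b 0 0
  rw [add_zero] at this
  omega

lemma hom_comm (a b : M) : F.hom a b = F.hom b a := by
  refine F.induction (fun a => ∀ b, F.hom a b = F.hom b a) ?_ ?_ a b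
  · intro b
    rw [hom_zero_left, hom_zero_right]
  · intro s hs x hx b
    rw [F.hom_add_left, F.hom_add_right, hx b]
    congr 1
    refine F.induction (fun b => F.hom s b = F.hom b s) ?_ ?_ b
    · rw [hom_zero_left, hom_zero_right]
    · intro t ht y hy
      rw [F.hom_add_left, F.hom_add_right, hy]
      congr 1
      by_cases h : s = t
      · rw [h]
      · rw [F.hom_ne s hs t ht h, F.hom_ne t ht s hs (Ne.symm h)]

lemma eq_zero_or (x : M) : x = 0 ∨ ∃ s ∈ F.simple, ∃ y, x = s + y :=
  F.induction (fun x => x = 0 ∨ ∃ s ∈ F.simple, ∃ y, x = s + y) (Or.inl rfl)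
    (fun s hs y _ => Or.inr ⟨s, hs, y, rfl⟩) x

lemma eq_zero_of_hom_self {x : M} (h : F.hom x x = 0) : x = 0 := by
  rcases F.eq_zero_or x with h0 | ⟨s, hs, y, rfl⟩
  · exact h0
  · rw [F.hom_add_left, F.hom_add_right, F.hom_self s hs] at h
    omega

lemma mem_simple_of_hom_self {x : M} (h : F.hom x x = 1) : x ∈ F.simple := by
  rcases F.eq_zero_or x with rfl | ⟨s, hs, y, rfl⟩
  · rw [hom_zero_left] at h
    omega
  · rw [F.hom_add_left, F.hom_add_right, F.hom_self s hs, F.hom_add_right] at h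
    have : y = 0 := F.eq_zero_of_hom_self (by omega)
    rwa [this, add_zero]

lemma exists_add_of_hom_self_eq_two {x : M} (h : F.hom x x = 2) :
    ∃ s ∈ F.simple, ∃ t ∈ F.simple, s ≠ t ∧ x = s + t := by
  rcases F.eq_zero_or x with rfl | ⟨s, hs, y, rfl⟩
  · rw [hom_zero_left] at h
    omega
  · rw [F.hom_add_left, F.hom_add_right, F.hom_self s hs, F.hom_add_right, F.hom_comm y s] at h
    have hy : y ∈ F.simple := F.mem_simple_of_hom_self (by omega)
    refine ⟨s, hs, y, hy, ?_, rfl⟩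
    rintro rfl
    rw [F.hom_self s hs] at h
    omega

variable {F}

lemma eq_of_hom_ne_zero {s t : M} (hs : s ∈ F.simple) (ht : t ∈ F.simple) (h : F.hom s t ≠ 0) :
    s = t := by
  by_contra hne
  exact h (F.hom_ne s hs t ht hne)

lemma ne_zero_of_mem {s : M} (hs : s ∈ F.simple) : s ≠ 0 := by
  rintro rfl
  have := F.hom_self 0 hs
  rw [hom_zero_left] at this
  omega

lemma exists_add_of_hom_ne_zero {s x : M} (hs : s ∈ F.simple) (h : F.hom s x ≠ 0) :
    ∃ y, x = s + y := by
  revert h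
  refine F.induction (fun x => F.hom s x ≠ 0 → ∃ y, x = s + y) ?_ ?_ x
  · intro h
    rw [hom_zero_right] at h
    omega
  · intro t ht y hy h
    by_cases hst : s = t
    · exact ⟨y, by rw [hst]⟩
    · rw [F.hom_add_right, F.hom_ne s hs t ht hst, zero_add] at h
      obtain ⟨z, rfl⟩ := hy h
      exact ⟨t + z, by abel⟩

variable (F)

/-- `s` and `t` are dual to each other. -/
structure IsDual (s t : M) : Prop where
  mul_left : ∀ a b, F.hom (a * s) b = F.hom a (b * t)
  left_mul : ∀ a b, F.hom (t * a) b = F.hom a (s * b)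

variable {F}

namespace IsDual

variable {s t s' t' : M}

lemma symm (h : F.IsDual s t) : F.IsDual t s where
  mul_left a b := by rw [F.hom_comm, ← h.mul_left, F.hom_comm]
  left_mul a b := by rw [F.hom_comm, ← h.left_mul, F.hom_comm]

lemma mul (h : F.IsDual s s') (h' : F.IsDual t t') : F.IsDual (s * t) (t' * s') where
  mul_left a b := by rw [← mul_assoc, h'.mul_left, h.mul_left, mul_assoc]
  left_mul a b := by rw [mul_assoc, h'.left_mul, h.left_mul, mul_assoc]

lemma hom_one_mul (h : F.IsDual s s') : F.hom 1 (s * s') = F.hom s s := by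
  rw [← h.mul_left, one_mul]

lemma mem_simple (h : F.IsDual s s') (hs : s ∈ F.simple) : s' ∈ F.simple := by
  apply F.mem_simple_of_hom_self
  have := h.left_mul 1 s'
  rw [mul_one] at this
  rw [this, h.hom_one_mul, F.hom_self s hs]

lemma unique (h : F.IsDual s t) (h' : F.IsDual s t') (hs : s ∈ F.simple) : t = t' := by
  refine eq_of_hom_ne_zero (h.mem_simple hs) (h'.mem_simple hs) ?_
  have := h.left_mul 1 t'
  rw [mul_one] at this
  rw [this, h'.hom_one_mul, F.hom_self s hs]
  exact one_ne_zero

/-- One-sided inverses of simple elements by duals are two-sided. -/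
lemma mul_eq_one_symm (h : F.IsDual s s') (hs : s ∈ F.simple) (h1 : s * s' = 1) : s' * s = 1 := by
  have hsimple : s' * s ∈ F.simple := by
    apply F.mem_simple_of_hom_self
    rw [h.left_mul, ← mul_assoc, h1, one_mul, F.hom_self s hs]
  refine (eq_of_hom_ne_zero F.one_mem hsimple ?_).symm
  rw [h.symm.hom_one_mul, F.hom_self _ (h.mem_simple hs)]
  exact one_ne_zero

lemma mul_mem_simple_left (h : F.IsDual s s') (hs : s ∈ F.simple) (h1 : s * s' = 1)
    (ht : t ∈ F.simple) : s * t ∈ F.simple := by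
  apply F.mem_simple_of_hom_self
  rw [h.symm.left_mul, ← mul_assoc, h.mul_eq_one_symm hs h1, one_mul, F.hom_self t ht]

lemma mul_mem_simple_right (h : F.IsDual s s') (h1 : s * s' = 1)
    (ht : t ∈ F.simple) : t * s ∈ F.simple := by
  apply F.mem_simple_of_hom_self
  rw [h.mul_left, mul_assoc, h1, mul_one, F.hom_self t ht]

end IsDual

lemma exists_isDual {s : M} (hs : s ∈ F.simple) : ∃ s', F.IsDual s s' := by
  obtain ⟨s', h⟩ := F.exists_dual s hs
  exact ⟨s', fun a b => (h a b).1, fun a b => (h a b).2⟩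

variable (F)

/-- `χ` is a simple element of order two such that `s * s'` is `1` or `1 + χ` for all simple
elements `s` with dual `s'`, and is `1 + χ` at least once. -/
structure IsKernel (χ : M) : Prop where
  mem : χ ∈ F.simple
  ne_one : χ ≠ 1
  mul_self : χ * χ = 1
  mul_dual : ∀ s ∈ F.simple, ∀ s', F.IsDual s s' → s * s' = 1 ∨ s * s' = 1 + χ
  exists_ne : ∃ s ∈ F.simple, ∃ s', F.IsDual s s' ∧ s * s' = 1 + χ

variable {F}

lemma isDual_self {χ : M} (mem : χ ∈ F.simple) (h : χ * χ = 1) : F.IsDual χ χ := by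
  obtain ⟨χ', hd⟩ := exists_isDual mem
  have : χ' = χ := by
    refine eq_of_hom_ne_zero (hd.mem_simple mem) mem ?_
    have := hd.left_mul 1 χ
    rw [mul_one, h, F.hom_self 1 F.one_mem] at this
    rw [this]
    exact one_ne_zero
  rwa [this] at hd

namespace IsKernel

variable {χ : M} (K : F.IsKernel χ) {s s' t t' : M}

include K

lemma isDual : F.IsDual χ χ := isDual_self K.mem K.mul_self

lemma mul_left_mem (hs : s ∈ F.simple) : χ * s ∈ F.simple :=
  K.isDual.mul_mem_simple_left K.mem K.mul_self hs

lemma mul_right_mem (hs : s ∈ F.simple) : s * χ ∈ F.simple :=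
  K.isDual.mul_mem_simple_right K.mul_self hs

lemma hom_one : F.hom χ 1 = 0 := F.hom_ne _ K.mem _ F.one_mem K.ne_one

lemma chi_mul_eq_self (hd : F.IsDual s s') (hs : s ∈ F.simple) (h : s * s' = 1 + χ) : χ * s = s := by
  refine eq_of_hom_ne_zero (K.mul_left_mem hs) hs ?_
  rw [hd.mul_left, h, F.hom_add_right, F.hom_self _ K.mem]
  omega

lemma mul_dual_eq_one_iff (hd : F.IsDual s s') (hs : s ∈ F.simple) :
    s * s' = 1 ↔ χ * s ≠ s := by
  constructor
  · intro h h'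
    have := hd.mul_left χ s
    rw [h, h', F.hom_self s hs, K.hom_one] at this
    omega
  · intro h
    rcases K.mul_dual s hs s' hd with h' | h'
    · exact h'
    · exact absurd (K.chi_mul_eq_self hd hs h') h

lemma mul_dual_of_eq (hd : F.IsDual s s') (hs : s ∈ F.simple) (h : χ * s = s) :
    s * s' = 1 + χ := by
  rcases K.mul_dual s hs s' hd with h' | h'
  · exact absurd h ((K.mul_dual_eq_one_iff hd hs).1 h')
  · exact h'

lemma one_ne : (1 : M) ≠ 1 + χ := by
  intro h
  have := congrArg (F.hom χ) h
  rw [F.hom_add_right, F.hom_self χ K.mem, K.hom_one] at this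
  omega

lemma dual_mul_of_eq (hd : F.IsDual s s') (hs : s ∈ F.simple) (h : χ * s = s) :
    s' * s = 1 + χ := by
  rcases K.mul_dual s' (hd.mem_simple hs) s hd.symm with h' | h'
  · exact absurd ((hd.symm.mul_eq_one_symm (hd.mem_simple hs) h').symm.trans
      (K.mul_dual_of_eq hd hs h)) K.one_ne
  · exact h'

lemma mul_chi_of_eq (hs : s ∈ F.simple) (h : χ * s = s) : s * χ = s := by
  obtain ⟨s', hd⟩ := F.exists_isDual hs
  refine eq_of_hom_ne_zero (K.mul_right_mem hs) hs ?_
  rw [hd.symm.left_mul, K.dual_mul_of_eq hd hs h, F.hom_add_right, F.hom_self _ K.mem]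
  omega

lemma commute_simple (hs : s ∈ F.simple) : χ * s = s * χ := by
  by_cases h : χ * s = s
  · rw [h, K.mul_chi_of_eq hs h]
  · obtain ⟨s', hd⟩ := F.exists_isDual hs
    obtain ⟨x, hx, x', hdx, hxx⟩ := K.exists_ne
    have h1 := (K.mul_dual_eq_one_iff hd hs).2 h
    have h2 := hd.mul_eq_one_symm hs h1
    have hsx := hd.mul_mem_simple_left hs h1 hx
    have key : s * x * (x' * s') = 1 + s * χ * s' := by
      rw [mul_assoc, ← mul_assoc x, hxx, add_mul, one_mul, mul_add, h1, mul_assoc]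
    have hmem : s * χ * s' ∈ F.simple :=
      hd.symm.mul_mem_simple_right h2 (K.mul_right_mem hs)
    have hχ : s * χ * s' = χ := by
      refine eq_of_hom_ne_zero hmem K.mem ?_
      rcases K.mul_dual _ hsx _ (hd.mul hdx) with h' | h'
      · rw [key] at h'
        have := congrArg (F.hom 1) h'
        have h3 := congrArg (F.hom (s * χ * s')) h'
        rw [F.hom_add_right, F.hom_self _ hmem] at h3
        rw [F.hom_add_right, F.hom_self _ F.one_mem] at this
        rw [F.hom_comm] at h3
        omega
      · rw [key] at h'
        have h3 := congrArg (F.hom (s * χ * s')) h'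
        rw [F.hom_add_right, F.hom_add_right, F.hom_self _ hmem] at h3
        omega
    calc χ * s = s * χ * s' * s := by rw [hχ]
      _ = s * χ := by rw [mul_assoc, h2, mul_one]

lemma commute (x : M) : χ * x = x * χ := by
  refine F.induction (fun x => χ * x = x * χ) (by simp) ?_ x
  intro s hs y hy
  rw [mul_add, add_mul, hy, K.commute_simple hs]

/-- A product of two noninvertible simple elements is `a + χ * a` for an invertible `a`. -/
lemma exists_mul_eq (hs : s ∈ F.simple) (ht : t ∈ F.simple) (h : χ * s = s) (h' : χ * t = t) :
    ∃ a ∈ F.simple, χ * a ≠ a ∧ s * t = a + χ * a := by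
  obtain ⟨s', hd⟩ := F.exists_isDual hs
  have h2 : F.hom (s * t) (s * t) = 2 := by
    rw [hd.symm.left_mul, ← mul_assoc, K.dual_mul_of_eq hd hs h, add_mul, one_mul, h',
      F.hom_add_right, F.hom_self t ht]
  obtain ⟨a, ha, b, hb, hab, hst⟩ := F.exists_add_of_hom_self_eq_two h2
  have hbχ : b = χ * a := by
    have : F.hom t (s' * a) ≠ 0 := by
      rw [F.hom_comm, hd.left_mul, hst, F.hom_add_right, F.hom_self a ha]
      omega
    obtain ⟨y, hy⟩ := exists_add_of_hom_ne_zero ht this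
    refine eq_of_hom_ne_zero hb (K.mul_left_mem ha) ?_
    have h3 : a + χ * a = a + b + s * y := by
      rw [← hst, ← mul_add, ← hy, ← mul_assoc, K.mul_dual_of_eq hd hs h, add_mul, one_mul]
    have h4 := congrArg (F.hom b) h3
    rw [F.hom_add_right, F.hom_add_right, F.hom_add_right, F.hom_self b hb,
      F.hom_ne b hb a ha (Ne.symm hab)] at h4
    omega
  refine ⟨a, ha, ?_, ?_⟩
  · rw [← hbχ]
    exact Ne.symm hab
  · rw [hst, hbχ]

lemma mul_mem (hs : s ∈ F.simple) (ht : t ∈ F.simple) (h : χ * s ≠ s ∨ χ * t ≠ t) :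
    s * t ∈ F.simple := by
  obtain ⟨s', hd⟩ := F.exists_isDual hs
  obtain ⟨t', hdt⟩ := F.exists_isDual ht
  rcases h with h | h
  · exact hd.mul_mem_simple_left hs ((K.mul_dual_eq_one_iff hd hs).2 h) ht
  · exact hdt.mul_mem_simple_right ((K.mul_dual_eq_one_iff hdt ht).2 h) hs

lemma chi_mul_mul_iff (hs : s ∈ F.simple) :
    χ * (s * t) = s * t ↔ χ * s = s ∨ χ * t = t := by
  obtain ⟨s', hd⟩ := F.exists_isDual hs
  constructor
  · intro he
    by_contra! hcon
    have h1 := hd.mul_eq_one_symm hs ((K.mul_dual_eq_one_iff hd hs).2 hcon.1)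
    apply hcon.2
    calc χ * t = s' * (χ * (s * t)) := by
          rw [← mul_assoc χ, K.commute s, ← mul_assoc s', ← mul_assoc s', h1, one_mul]
      _ = t := by rw [he, ← mul_assoc, h1, one_mul]
  · rintro (h | h)
    · rw [← mul_assoc, h]
    · rw [← mul_assoc, K.commute, mul_assoc, h]

end IsKernel

end FusionData

namespace FusionData

variable {M : Type*} [Semiring M] {F : FusionData M}

lemma sqrt_two_bounds : 1 < Real.sqrt 2 ∧ Real.sqrt 2 < 3 / 2 ∧
    Real.sqrt 2 * Real.sqrt 2 = 2 := by
  refine ⟨?_, ?_, Real.mul_self_sqrt (by norm_num)⟩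
  · rw [Real.lt_sqrt] <;> norm_num
  · rw [Real.sqrt_lt'] <;> norm_num

section Weight

variable {χ : M}

open Classical in
/-- The dimension of a simple element. -/
noncomputable def weight (χ s : M) : ℝ := if χ * s = s then Real.sqrt 2 else 1

lemma one_le_weight (s : M) : 1 ≤ weight χ s := by
  unfold weight
  split_ifs
  · exact sqrt_two_bounds.1.le
  · exact le_rfl

lemma weight_of_eq {s : M} (h : χ * s = s) : weight χ s = Real.sqrt 2 := if_pos h

lemma weight_of_ne {s : M} (h : χ * s ≠ s) : weight χ s = 1 := if_neg h

variable (F) in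
/-- The additive extension of `weight`. -/
noncomputable def weightSum (χ : M) : M →+ ℝ where
  toFun x := ∑ s ∈ F.finite.toFinset, F.hom s x * weight χ s
  map_zero' := by simp [hom_zero_right]
  map_add' x y := by simp [F.hom_add_right, add_mul, Finset.sum_add_distrib]

lemma weightSum_simple {s : M} (hs : s ∈ F.simple) : F.weightSum χ s = weight χ s := by
  have hs' : s ∈ F.finite.toFinset := by simpa using hs
  change ∑ t ∈ F.finite.toFinset, F.hom t s * weight χ t = weight χ s
  rw [Finset.sum_eq_single_of_mem s hs', F.hom_self s hs, Nat.cast_one, one_mul]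
  intro t ht hts
  rw [F.hom_ne t (by simpa using ht) s hs hts, Nat.cast_zero, zero_mul]

lemma weightSum_nonneg (x : M) : 0 ≤ F.weightSum χ x :=
  Finset.sum_nonneg fun s _ => mul_nonneg (Nat.cast_nonneg _)
    (zero_le_one.trans (one_le_weight s))

lemma one_le_weightSum {x : M} (hx : x ≠ 0) : 1 ≤ F.weightSum χ x := by
  rcases F.eq_zero_or x with h | ⟨s, hs, y, rfl⟩
  · exact absurd h hx
  · rw [map_add, weightSum_simple hs]
    have h1 := weightSum_nonneg (F := F) (χ := χ) y
    have h2 := one_le_weight (χ := χ) s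
    linarith

namespace IsKernel

variable (K : F.IsKernel χ)

include K

lemma weightSum_one : F.weightSum χ 1 = 1 := by
  rw [weightSum_simple F.one_mem, weight_of_ne]
  rw [mul_one]
  exact K.ne_one

lemma weightSum_mul_simple {s t : M} (hs : s ∈ F.simple) (ht : t ∈ F.simple) :
    F.weightSum χ (s * t) = weight χ s * weight χ t := by
  by_cases h : χ * s ≠ s ∨ χ * t ≠ t
  · rw [weightSum_simple (K.mul_mem hs ht h)]
    have := K.chi_mul_mul_iff (t := t) hs
    by_cases h1 : χ * s = s
    · rw [weight_of_eq h1, weight_of_ne (h.resolve_left (not_not.2 h1)), mul_one,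
        weight_of_eq (this.2 (Or.inl h1))]
    · rw [weight_of_ne h1, one_mul]
      by_cases h2 : χ * t = t
      · rw [weight_of_eq h2, weight_of_eq (this.2 (Or.inr h2))]
      · rw [weight_of_ne h2, weight_of_ne]
        rw [Ne, this]
        tauto
  · push Not at h
    obtain ⟨a, ha, hne, hst⟩ := K.exists_mul_eq hs ht h.1 h.2
    have hne' : χ * (χ * a) ≠ χ * a := by
      rw [← mul_assoc, K.mul_self, one_mul]
      exact Ne.symm hne
    rw [hst, map_add, weightSum_simple ha, weightSum_simple (K.mul_left_mem ha),
      weight_of_ne hne, weight_of_ne hne', weight_of_eq h.1, weight_of_eq h.2,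
      sqrt_two_bounds.2.2]
    norm_num

/-- The dimension as a homomorphism of semirings. -/
noncomputable def dim : M →+* ℝ where
  __ := F.weightSum χ
  map_one' := K.weightSum_one
  map_mul' x y := by
    change F.weightSum χ (x * y) = F.weightSum χ x * F.weightSum χ y
    refine F.induction
      (fun x => F.weightSum χ (x * y) = F.weightSum χ x * F.weightSum χ y) (by simp) ?_ x
    intro s hs x hx
    rw [add_mul, map_add, map_add, add_mul, hx]
    congr 1
    refine F.induction
      (fun y => F.weightSum χ (s * y) = F.weightSum χ s * F.weightSum χ y) (by simp) ?_ y
    intro t ht y hy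
    rw [mul_add, map_add, map_add, mul_add, hy, K.weightSum_mul_simple hs ht,
      weightSum_simple hs, weightSum_simple ht]

lemma one_le_dim {x : M} (hx : x ≠ 0) : 1 ≤ K.dim x := one_le_weightSum hx

/-- Any homomorphism with values at least one on nonzero elements is the dimension. -/
lemma map_simple (d : M →+* ℝ) (hd : ∀ x ≠ 0, 1 ≤ d x) {s : M} (hs : s ∈ F.simple) :
    d s = weight χ s := by
  have key : ∀ t ∈ F.simple, χ * t ≠ t → d t = 1 := by
    intro t ht h
    obtain ⟨t', hdt⟩ := F.exists_isDual ht
    have h1 := (K.mul_dual_eq_one_iff hdt ht).2 h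
    have h2 := congrArg d h1
    rw [map_mul, map_one] at h2
    have h3 := hd t (ne_zero_of_mem ht)
    have h4 := hd t' (ne_zero_of_mem (hdt.mem_simple ht))
    nlinarith
  by_cases h : χ * s = s
  · obtain ⟨a, ha, hne, hst⟩ := K.exists_mul_eq hs hs h h
    have hne' : χ * (χ * a) ≠ χ * a := by
      rw [← mul_assoc, K.mul_self, one_mul]
      exact Ne.symm hne
    have h1 := congrArg d hst
    rw [map_mul, map_add, key a ha hne, key _ (K.mul_left_mem ha) hne'] at h1
    have h3 := hd s (ne_zero_of_mem hs)
    rw [weight_of_eq h, eq_comm, Real.sqrt_eq_iff_mul_self_eq] <;> linarith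
  · rw [weight_of_ne h, key s hs h]

end IsKernel

end Weight

section OfDim

variable {d : M →+* ℝ} (hd : ∀ s ∈ F.simple, d s = 1 ∨ d s = Real.sqrt 2)

include hd

lemma one_le_of_values {s : M} (hs : s ∈ F.simple) : 1 ≤ d s := by
  have := sqrt_two_bounds
  rcases hd s hs with h | h <;> linarith

lemma nonneg_of_values (x : M) : 0 ≤ d x := by
  refine F.induction (fun x => 0 ≤ d x) (by simp) ?_ x
  intro s hs y hy
  rw [map_add]
  have := one_le_of_values hd hs
  linarith

lemma mem_simple_of_lt_two {x : M} (h0 : x ≠ 0) (h : d x < 2) : x ∈ F.simple := by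
  rcases F.eq_zero_or x with h' | ⟨s, hs, y, rfl⟩
  · exact absurd h' h0
  · rcases F.eq_zero_or y with rfl | ⟨t, ht, z, rfl⟩
    · rwa [add_zero]
    · rw [map_add, map_add] at h
      have h1 := one_le_of_values hd hs
      have h2 := one_le_of_values hd ht
      have h3 := nonneg_of_values hd z
      linarith

lemma mem_simple_of_eq_one {x : M} (h : d x = 1) : x ∈ F.simple := by
  refine mem_simple_of_lt_two hd ?_ (by linarith)
  rintro rfl
  simp at h

lemma mem_simple_of_eq_sqrt {x : M} (h : d x = Real.sqrt 2) : x ∈ F.simple := by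
  have := sqrt_two_bounds
  refine mem_simple_of_lt_two hd ?_ (by linarith)
  rintro rfl
  rw [map_zero] at h
  linarith

lemma exists_add_of_eq_two {x : M} (h : d x = 2) :
    ∃ a ∈ F.simple, ∃ y, d a = 1 ∧ x = a + y := by
  have hb := sqrt_two_bounds
  rcases F.eq_zero_or x with rfl | ⟨s, hs, y, rfl⟩
  · simp at h
  · refine ⟨s, hs, y, ?_, rfl⟩
    rcases hd s hs with h1 | h1
    · exact h1
    · rw [map_add, h1] at h
      rcases F.eq_zero_or y with rfl | ⟨t, ht, z, rfl⟩
      · rw [map_zero] at h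
        linarith
      · rw [map_add] at h
        have h2 := one_le_of_values hd ht
        have h3 := nonneg_of_values hd z
        linarith

lemma mul_dual_of_values {s s' : M} (hs : s ∈ F.simple) (hdual : F.IsDual s s') :
    (s * s' = 1 ∧ d s = 1) ∨
      (d s = Real.sqrt 2 ∧ d s' = Real.sqrt 2 ∧
        ∃ χ ∈ F.simple, d χ = 1 ∧ χ ≠ 1 ∧ s * s' = 1 + χ) := by
  have hb := sqrt_two_bounds
  have hone : F.hom 1 (s * s') = 1 := by rw [hdual.hom_one_mul, F.hom_self s hs]
  obtain ⟨y, hy⟩ := exists_add_of_hom_ne_zero F.one_mem (by rw [hone]; exact one_ne_zero)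
  have hdy := congrArg d hy
  rw [map_mul, map_add, map_one] at hdy
  have hlt : d y < 1 → y = 0 := by
    intro h
    rcases F.eq_zero_or y with h' | ⟨t, ht, z, rfl⟩
    · exact h'
    · rw [map_add] at h
      have h2 := one_le_of_values hd ht
      have h3 := nonneg_of_values hd z
      linarith
  rcases hd s hs with h1 | h1
  · left
    rw [h1] at hdy
    have : y = 0 := by
      apply hlt
      rcases hd s' (hdual.mem_simple hs) with h2 | h2 <;> rw [h2] at hdy <;> linarith
    exact ⟨by rw [hy, this, add_zero], h1⟩
  · right
    rcases hd s' (hdual.mem_simple hs) with h2 | h2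
    · rw [h1, h2] at hdy
      have := hlt (by linarith)
      rw [this, map_zero] at hdy
      linarith
    · rw [h1, h2, hb.2.2] at hdy
      have hy1 : d y = 1 := by linarith
      refine ⟨h1, h2, y, mem_simple_of_eq_one hd hy1, hy1, ?_, hy⟩
      rintro rfl
      rw [hy, F.hom_add_right, F.hom_self _ F.one_mem] at hone
      omega

lemma mul_dual_eq_of_values {s s' t t' : M} (hs : s ∈ F.simple) (ht : t ∈ F.simple)
    (hds : F.IsDual s s') (hdt : F.IsDual t t') (h : d s = Real.sqrt 2) (h' : d t = Real.sqrt 2) :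
    t * t' = s' * s := by
  have hb := sqrt_two_bounds
  have hs' : d s' = Real.sqrt 2 := by
    rcases mul_dual_of_values hd hs hds with h1 | h1
    · linarith [h1.2]
    · exact h1.2.1
  obtain ⟨a, ha, y, ha1, hy⟩ := exists_add_of_eq_two hd (x := s * t) (by rw [map_mul, h, h', hb.2.2])
  obtain ⟨a', hda⟩ := F.exists_isDual ha
  have haa : a * a' = 1 := by
    rcases mul_dual_of_values hd ha hda with h1 | h1
    · exact h1.1
    · linarith [h1.1]
  have hmem : s' * a ∈ F.simple := mem_simple_of_eq_sqrt hd (by rw [map_mul, hs', ha1, mul_one])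
  have hta : s' * a = t := by
    refine eq_of_hom_ne_zero hmem ht ?_
    rw [hds.left_mul, hy, F.hom_add_right, F.hom_self a ha]
    omega
  have hdual := hds.symm.mul hda
  rw [hta] at hdual
  rw [hdt.unique hdual ht, ← hta, mul_assoc, ← mul_assoc a, haa, one_mul]

lemma exists_isKernel_of_values {s : M} (hs : s ∈ F.simple) (h : d s = Real.sqrt 2) :
    ∃ χ, F.IsKernel χ := by
  have hb := sqrt_two_bounds
  obtain ⟨s', hdual⟩ := F.exists_isDual hs
  have hss := mul_dual_of_values hd hs hdual
  rcases hss with h1 | ⟨-, hs', χ, hχ, hχ1, hne, hss⟩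
  · linarith [h1.2]
  have hdχ : F.IsDual χ χ ∧ χ * χ = 1 := by
    obtain ⟨χ', hd'⟩ := F.exists_isDual hχ
    have hχχ' : χ * χ' = 1 := by
      rcases mul_dual_of_values hd hχ hd' with h1 | h1
      · exact h1.1
      · linarith [h1.1]
    have hχs : χ * s = s := by
      refine eq_of_hom_ne_zero (hd'.mul_mem_simple_left hχ hχχ' hs) hs ?_
      rw [hdual.mul_left, hss, F.hom_add_right, F.hom_self χ hχ]
      omega
    have hmem := hd'.mul_mem_simple_left hχ hχχ' hχ
    have : χ * χ = 1 := by
      have h1 := hdual.mul_left (χ * χ) s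
      rw [mul_assoc, hχs, hχs, F.hom_self s hs, hss, F.hom_add_right] at h1
      by_contra hcon
      rw [F.hom_ne _ hmem _ F.one_mem hcon, zero_add] at h1
      have h2 := eq_of_hom_ne_zero hmem hχ (by rw [← h1]; exact one_ne_zero)
      apply hne
      calc χ = χ * (χ * χ') := by rw [hχχ', mul_one]
        _ = χ * χ' := by rw [← mul_assoc, h2]
        _ = 1 := hχχ'
    exact ⟨isDual_self hχ this, this⟩
  refine ⟨χ, hχ, hne, hdχ.2, ?_, s, hs, s', hdual, hss⟩
  intro t ht t' hdt
  rcases mul_dual_of_values hd ht hdt with h1 | h1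
  · exact Or.inl h1.1
  · right
    rw [mul_dual_eq_of_values hd hs ht hdual hdt h h1.1,
      ← mul_dual_eq_of_values hd hs hs hdual hdual h h, hss]

end OfDim

end FusionData

namespace FusionData

variable {M : Type*} [Semiring M] {F : FusionData M} {χ : M}

lemma hom_nsmul (n : ℕ) (a b : M) : F.hom a (n • b) = n * F.hom a b := by
  induction n with
  | zero => rw [zero_smul, hom_zero_right, zero_mul]
  | succ n ih => rw [succ_nsmul, F.hom_add_right, ih, Nat.succ_mul]

/-- The elements `(1 + χ) * s` for `s` simple. -/
def Coset (_ : F.IsKernel χ) : Type _ := {g : M // ∃ s ∈ F.simple, g = (1 + χ) * s}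

namespace Coset

variable (K : F.IsKernel χ)

/-- The coset of a simple element. -/
def mk {s : M} (hs : s ∈ F.simple) : Coset K := ⟨(1 + χ) * s, s, hs, rfl⟩

include K in
lemma one_add_mul_chi (s : M) : (1 + χ) * (χ * s) = (1 + χ) * s := by
  rw [← mul_assoc, add_mul, one_mul, K.mul_self, add_comm]

include K in
lemma one_add_mul_one_add (s : M) : (1 + χ) * ((1 + χ) * s) = 2 • ((1 + χ) * s) := by
  rw [add_mul 1 χ s, mul_add (1 + χ), one_mul, one_add_mul_chi K, two_nsmul, add_mul, one_mul]

include K in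
lemma one_add_commute (x : M) : (1 + χ) * x = x * (1 + χ) := by
  rw [add_mul, mul_add, K.commute, one_mul, mul_one]

include K in
lemma one_add_mul_mul (x y : M) : (1 + χ) * x * ((1 + χ) * y) = 2 • ((1 + χ) * (x * y)) := by
  rw [mul_assoc, ← mul_assoc x, ← one_add_commute K x, mul_assoc, one_add_mul_one_add K]

include K in
lemma mul_eq_of_hom_ne_zero {s t u : M} (hs : s ∈ F.simple) (ht : t ∈ F.simple)
    (hu : u ∈ F.simple) (h : F.hom u (s * t) ≠ 0) :
    ∃ n : ℕ, 0 < n ∧ (1 + χ) * s * ((1 + χ) * t) = n • ((1 + χ) * u) := by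
  rw [one_add_mul_mul K]
  by_cases hne : χ * s ≠ s ∨ χ * t ≠ t
  · refine ⟨2, two_pos, ?_⟩
    rw [eq_of_hom_ne_zero hu (K.mul_mem hs ht hne) h]
  · push Not at hne
    obtain ⟨a, ha, -, hst⟩ := K.exists_mul_eq hs ht hne.1 hne.2
    refine ⟨2 * 2, by norm_num, ?_⟩
    have hua : (1 + χ) * u = (1 + χ) * a := by
      rw [hst, F.hom_add_right] at h
      by_cases h1 : F.hom u a = 0
      · rw [h1, zero_add] at h
        rw [eq_of_hom_ne_zero hu (K.mul_left_mem ha) h, one_add_mul_chi K]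
      · rw [eq_of_hom_ne_zero hu ha h1]
    rw [hua, hst, mul_add, one_add_mul_chi K, ← two_nsmul, smul_smul]

variable {K}

lemma eq_of_nsmul_eq {g h : Coset K} {m n : ℕ} (hm : 0 < m)
    (heq : m • g.1 = n • h.1) : g = h := by
  obtain ⟨_, s, hs, rfl⟩ := g
  obtain ⟨_, t, ht, rfl⟩ := h
  change m • ((1 + χ) * s) = n • ((1 + χ) * t) at heq
  have h1 := congrArg (F.hom s) heq
  apply Subtype.ext
  change (1 + χ) * s = (1 + χ) * t
  have h2 : F.hom s ((1 + χ) * t) ≠ 0 := by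
    intro h0
    rw [hom_nsmul, hom_nsmul, h0, add_mul, one_mul, F.hom_add_right, F.hom_self s hs] at h1
    have : 0 < m * (1 + F.hom s (χ * s)) := Nat.mul_pos hm (by omega)
    omega
  rw [add_mul, one_mul, F.hom_add_right] at h2
  by_cases h3 : F.hom s t = 0
  · rw [h3, zero_add] at h2
    rw [eq_of_hom_ne_zero hs (K.mul_left_mem ht) h2, one_add_mul_chi K]
  · rw [eq_of_hom_ne_zero hs ht h3]

lemma exists_mul (g h : Coset K) : ∃ k : Coset K, ∃ n : ℕ, 0 < n ∧ g.1 * h.1 = n • k.1 := by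
  obtain ⟨_, s, hs, rfl⟩ := g
  obtain ⟨_, t, ht, rfl⟩ := h
  obtain ⟨s', hd⟩ := F.exists_isDual hs
  have hne : s * t ≠ 0 := by
    intro h0
    have h1 := hd.symm.left_mul (t) (s * t)
    rcases K.mul_dual s' (hd.mem_simple hs) s hd.symm with h2 | h2
    · rw [h0, hom_zero_left, ← h0, ← mul_assoc, h2, one_mul, F.hom_self t ht] at h1
      omega
    · rw [h0, hom_zero_left, ← h0, ← mul_assoc, h2, add_mul, one_mul, F.hom_add_right,
        F.hom_self t ht] at h1
      omega
  rcases F.eq_zero_or (s * t) with h0 | ⟨u, hu, y, hy⟩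
  · exact absurd h0 hne
  · obtain ⟨n, hn, h⟩ := mul_eq_of_hom_ne_zero K hs ht hu
      (by rw [hy, F.hom_add_right, F.hom_self u hu]; omega)
    exact ⟨mk K hu, n, hn, h⟩

noncomputable instance : Mul (Coset K) := ⟨fun g h => (exists_mul g h).choose⟩

lemma mul_spec (g h : Coset K) : ∃ n : ℕ, 0 < n ∧ g.1 * h.1 = n • (g * h).1 :=
  (exists_mul g h).choose_spec

lemma mul_eq {g h k : Coset K} {n : ℕ} (heq : g.1 * h.1 = n • k.1) : g * h = k := by
  obtain ⟨m, hm, h'⟩ := mul_spec g h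
  exact eq_of_nsmul_eq hm (h'.symm.trans heq)

instance : One (Coset K) := ⟨mk K F.one_mem⟩

lemma one_val : (1 : Coset K).1 = 1 + χ := mul_one _

lemma exists_inv (g : Coset K) : ∃ h : Coset K, h * g = 1 := by
  obtain ⟨_, s, hs, rfl⟩ := g
  obtain ⟨s', hd⟩ := F.exists_isDual hs
  refine ⟨mk K (hd.mem_simple hs), ?_⟩
  obtain ⟨n, -, h⟩ := mul_eq_of_hom_ne_zero K (hd.mem_simple hs) hs F.one_mem
    (by rw [hd.symm.hom_one_mul, F.hom_self _ (hd.mem_simple hs)]; exact one_ne_zero)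
  exact mul_eq h

noncomputable instance : Inv (Coset K) := ⟨fun g => (exists_inv g).choose⟩

noncomputable instance : Group (Coset K) :=
  Group.ofLeftAxioms
    (fun a b c => by
      obtain ⟨m, hm, h1⟩ := mul_spec a b
      obtain ⟨n, hn, h2⟩ := mul_spec b c
      obtain ⟨p, hp, h3⟩ := mul_spec (a * b) c
      obtain ⟨q, hq, h4⟩ := mul_spec a (b * c)
      refine eq_of_nsmul_eq (m := m * p) (n := n * q) (Nat.mul_pos hm hp) ?_
      rw [mul_smul, mul_smul, ← h3, ← h4, ← smul_mul_assoc, ← mul_smul_comm, ← h1, ← h2, mul_assoc])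
    (fun g => by
      obtain ⟨s, hs, h⟩ := g.2
      refine mul_eq (n := 2) ?_
      rw [one_val, h, one_add_mul_one_add K])
    (fun g => (exists_inv g).choose_spec)

instance : Finite (Coset K) := by
  have := F.finite.image (fun s => (1 + χ) * s)
  refine Set.Finite.subset this ?_ |>.to_subtype
  rintro _ ⟨s, hs, rfl⟩
  exact ⟨s, hs, rfl⟩

lemma mk_mul_mk {s t u : M} (hs : s ∈ F.simple) (ht : t ∈ F.simple)
    (hu : u ∈ F.simple) (h : F.hom u (s * t) ≠ 0) : mk K hs * mk K ht = mk K hu := by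
  obtain ⟨n, -, h⟩ := mul_eq_of_hom_ne_zero K hs ht hu h
  exact mul_eq h

end Coset

/-- The simple elements are graded by a finite group, with trivial component `{1, χ}`. -/
theorem IsKernel.exists_grading (K : F.IsKernel χ) :
    ∃ (G : Type) (_ : Group G) (_ : Finite G) (c : F.simple → G),
      (∀ s t u : F.simple, F.hom u.1 (s.1 * t.1) ≠ 0 → c u = c s * c t) ∧
      Function.Surjective c ∧ ∀ s : F.simple, c s = 1 ↔ s.1 = 1 ∨ s.1 = χ := by
  have : Small.{0} (Coset K) := Countable.toSmall _
  refine ⟨Shrink.{0} (Coset K), inferInstance, inferInstance,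
    fun s => equivShrink _ (Coset.mk K s.2), ?_, ?_, ?_⟩
  · intro s t u h
    rw [← equivShrink_mul, Coset.mk_mul_mk s.2 t.2 u.2 h]
  · intro g
    obtain ⟨⟨_, s, hs, rfl⟩, rfl⟩ := (equivShrink _).surjective g
    exact ⟨⟨s, hs⟩, rfl⟩
  · rintro ⟨s, hs⟩
    change equivShrink (Coset K) _ = equivShrink (Coset K) 1 ↔ s = 1 ∨ s = χ
    rw [(equivShrink _).injective.eq_iff]
    constructor
    · intro h
      have h1 := congrArg (fun g : Coset K => F.hom s g.1) h
      change F.hom s ((1 + χ) * s) = F.hom s (Subtype.val (1 : Coset K)) at h1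
      rw [Coset.one_val, add_mul, one_mul, F.hom_add_right, F.hom_add_right, F.hom_self s hs] at h1
      by_cases h2 : F.hom s 1 = 0
      · exact Or.inr (eq_of_hom_ne_zero hs K.mem (by omega))
      · exact Or.inl (eq_of_hom_ne_zero hs F.one_mem h2)
    · rintro (h | h)
      · subst h
        rfl
      · subst h
        apply Subtype.ext
        change (1 + s) * s = Subtype.val (1 : Coset K)
        rw [Coset.one_val, add_mul, one_mul, K.mul_self, add_comm]

end FusionData

namespace FusionCat

open scoped ZeroObject

attribute [local instance] Abelian.hasFiniteBiproducts

/-- The isomorphism classes of objects. -/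
def IsoClass (C : Type u) [Category.{v} C] : Type u := Quotient (isIsomorphicSetoid C)

namespace IsoClass

section Mk

variable {C : Type u} [Category.{v} C]

/-- The isomorphism class of an object. -/
def mk (X : C) : IsoClass C := Quotient.mk (isIsomorphicSetoid C) X

lemma mk_eq_mk {X Y : C} : mk X = mk Y ↔ Nonempty (X ≅ Y) := Quotient.eq

lemma mk_eq {X Y : C} (e : X ≅ Y) : mk X = mk Y := mk_eq_mk.2 ⟨e⟩

lemma exists_rep (x : IsoClass C) : ∃ X : C, mk X = x := Quotient.exists_rep x

end Mk

section Semiring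

variable {C : Type u} [Category.{v} C]

section Add

variable [Abelian C]

noncomputable instance : Add (IsoClass C) :=
  ⟨Quotient.map₂ (fun X Y => X ⊞ Y) fun _ _ ⟨e⟩ _ _ ⟨e'⟩ => ⟨biprod.mapIso e e'⟩⟩

noncomputable instance : Zero (IsoClass C) := ⟨mk 0⟩

lemma mk_biprod (X Y : C) : mk (X ⊞ Y) = mk X + mk Y := rfl

lemma mk_zero : mk (0 : C) = 0 := rfl

lemma mk_eq_zero_iff {X : C} : mk X = 0 ↔ IsZero X :=
  ⟨fun h => by
    obtain ⟨e⟩ := mk_eq_mk.1 (h.trans mk_zero.symm)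
    exact (isZero_zero C).of_iso e,
   fun h => mk_eq h.isoZero⟩

end Add

section Mul

variable [MonoidalCategory C]

instance : Mul (IsoClass C) :=
  ⟨Quotient.map₂ (fun X Y => X ⊗ Y) fun _ _ ⟨e⟩ _ _ ⟨e'⟩ => ⟨e ⊗ᵢ e'⟩⟩

instance : One (IsoClass C) := ⟨mk (𝟙_ C)⟩

lemma mk_tensor (X Y : C) : mk (X ⊗ Y) = mk X * mk Y := rfl

end Mul

variable [Abelian C] [MonoidalCategory C] [MonoidalPreadditive C]

noncomputable instance : Semiring (IsoClass C) where
  add_assoc x y z := by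
    obtain ⟨X, rfl⟩ := x.exists_rep
    obtain ⟨Y, rfl⟩ := y.exists_rep
    obtain ⟨Z, rfl⟩ := z.exists_rep
    exact mk_eq (biprod.associator X Y Z)
  zero_add x := by
    obtain ⟨X, rfl⟩ := x.exists_rep
    exact mk_eq (isoZeroBiprod (isZero_zero C)).symm
  add_zero x := by
    obtain ⟨X, rfl⟩ := x.exists_rep
    exact mk_eq (isoBiprodZero (isZero_zero C)).symm
  add_comm x y := by
    obtain ⟨X, rfl⟩ := x.exists_rep
    obtain ⟨Y, rfl⟩ := y.exists_rep
    exact mk_eq (biprod.braiding X Y)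
  nsmul := nsmulRec
  left_distrib x y z := by
    obtain ⟨X, rfl⟩ := x.exists_rep
    obtain ⟨Y, rfl⟩ := y.exists_rep
    obtain ⟨Z, rfl⟩ := z.exists_rep
    have := preservesBinaryBiproducts_of_preservesBiproducts (tensorLeft X)
    exact mk_eq ((tensorLeft X).mapBiprod Y Z)
  right_distrib x y z := by
    obtain ⟨X, rfl⟩ := x.exists_rep
    obtain ⟨Y, rfl⟩ := y.exists_rep
    obtain ⟨Z, rfl⟩ := z.exists_rep
    have := preservesBinaryBiproducts_of_preservesBiproducts (tensorRight Z)
    exact mk_eq ((tensorRight Z).mapBiprod X Y)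
  zero_mul x := by
    obtain ⟨X, rfl⟩ := x.exists_rep
    exact mk_eq_zero_iff.2 ((tensorRight X).map_isZero (isZero_zero C))
  mul_zero x := by
    obtain ⟨X, rfl⟩ := x.exists_rep
    exact mk_eq_zero_iff.2 ((tensorLeft X).map_isZero (isZero_zero C))
  mul_assoc x y z := by
    obtain ⟨X, rfl⟩ := x.exists_rep
    obtain ⟨Y, rfl⟩ := y.exists_rep
    obtain ⟨Z, rfl⟩ := z.exists_rep
    exact mk_eq (α_ X Y Z)
  one_mul x := by
    obtain ⟨X, rfl⟩ := x.exists_rep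
    exact mk_eq (λ_ X)
  mul_one x := by
    obtain ⟨X, rfl⟩ := x.exists_rep
    exact mk_eq (ρ_ X)

end Semiring

end IsoClass

section HomDim

variable (k : Type w) [Field k] {C : Type u} [Category.{v} C] [Abelian C] [Linear k C]

/-- The dimension of the space of morphisms between two objects. -/
noncomputable def homDim (X Y : C) : ℕ := Module.finrank k (X ⟶ Y)

lemma homDim_congr {X X' Y Y' : C} (e : X ≅ X') (e' : Y ≅ Y') :
    homDim k X Y = homDim k X' Y' :=
  (Linear.homCongr k e e').finrank_eq

variable {k} in
lemma homDim_ne_zero_iff {X Y : C} [FiniteDimensional k (X ⟶ Y)] :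
    homDim k X Y ≠ 0 ↔ ∃ f : X ⟶ Y, f ≠ 0 := by
  rw [← Module.finrank_pos_iff_exists_ne_zero (R := k), homDim, Nat.pos_iff_ne_zero]

/-- Morphisms out of a biproduct. -/
noncomputable def biprodHomEquiv (X Y Z : C) : (X ⊞ Y ⟶ Z) ≃ₗ[k] (X ⟶ Z) × (Y ⟶ Z) where
  toFun f := (biprod.inl ≫ f, biprod.inr ≫ f)
  invFun f := biprod.desc f.1 f.2
  map_add' f g := by simp
  map_smul' c f := by simp
  left_inv f := by ext <;> simp
  right_inv f := by simp

/-- Morphisms into a biproduct. -/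
noncomputable def homBiprodEquiv (X Y Z : C) : (X ⟶ Y ⊞ Z) ≃ₗ[k] (X ⟶ Y) × (X ⟶ Z) where
  toFun f := (f ≫ biprod.fst, f ≫ biprod.snd)
  invFun f := biprod.lift f.1 f.2
  map_add' f g := by simp
  map_smul' c f := by simp
  left_inv f := by ext <;> simp
  right_inv f := by simp

variable [∀ X Y : C, FiniteDimensional k (X ⟶ Y)]

lemma homDim_biprod_left (X Y Z : C) : homDim k (X ⊞ Y) Z = homDim k X Z + homDim k Y Z := by
  rw [homDim, (biprodHomEquiv k X Y Z).finrank_eq, Module.finrank_prod, homDim, homDim]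

lemma homDim_biprod_right (X Y Z : C) : homDim k X (Y ⊞ Z) = homDim k X Y + homDim k X Z := by
  rw [homDim, (homBiprodEquiv k X Y Z).finrank_eq, Module.finrank_prod, homDim, homDim]

end HomDim

section Dual

variable (k : Type w) [Field k] {C : Type u} [Category.{v} C] [Preadditive C] [Linear k C]
  [MonoidalCategory C] [MonoidalPreadditive C] [MonoidalLinear k C]

/-- The adjunction between tensoring on the right with an object and with its dual. -/
def tensorRightHomLinearEquiv (X Y Y' Z : C) [ExactPairing Y Y'] :
    (X ⊗ Y ⟶ Z) ≃ₗ[k] (X ⟶ Z ⊗ Y') where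
  __ := tensorRightHomEquiv X Y Y' Z
  map_add' f g := by simp [tensorRightHomEquiv]
  map_smul' c f := by simp [tensorRightHomEquiv]

/-- The adjunction between tensoring on the left with an object and with its dual. -/
def tensorLeftHomLinearEquiv (X Y Y' Z : C) [ExactPairing Y Y'] :
    (Y' ⊗ X ⟶ Z) ≃ₗ[k] (X ⟶ Y ⊗ Z) where
  __ := tensorLeftHomEquiv X Y Y' Z
  map_add' f g := by simp [tensorLeftHomEquiv]
  map_smul' c f := by simp [tensorLeftHomEquiv]

end Dual

section Biproducts

variable {C : Type u} [Category.{v} C] [Abelian C]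

/-- Splitting off the first summand of a biproduct. -/
noncomputable def biproductSuccIso {n : ℕ} (S : Fin (n + 1) → C) :
    ⨁ S ≅ S 0 ⊞ ⨁ fun i : Fin n => S i.succ where
  hom := biprod.lift (biproduct.π S 0) (biproduct.lift fun i => biproduct.π S i.succ)
  inv := biprod.desc (biproduct.ι S 0) (biproduct.desc fun i => biproduct.ι S i.succ)
  hom_inv_id := by
    rw [biprod.lift_desc, biproduct.lift_desc, ← biproduct.total, Fin.sum_univ_succ]
  inv_hom_id := by
    ext i j
    · simp
    · simp [biproduct.ι_π_ne _ (Fin.succ_ne_zero _).symm]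
    · simp [biproduct.ι_π_ne _ (Fin.succ_ne_zero _)]
    · by_cases h : i = j
      · subst h
        simp
      · simp [biproduct.ι_π_ne _ h, biproduct.ι_π_ne _ (fun h' => h (Fin.succ_injective _ h'))]

lemma isZero_biproduct_of_isEmpty {J : Type} [Finite J] [IsEmpty J] (S : J → C) :
    IsZero (⨁ S) := by
  rw [IsZero.iff_id_eq_zero]
  ext i
  exact isEmptyElim i

end Biproducts

section Fusion

variable (k : Type w) [Field k] {C : Type u} [Category.{v} C] [Abelian C] [Linear k C]
  [MonoidalCategory C] [MonoidalPreadditive C] [MonoidalLinear k C] [IsFusionCategory k C]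

include k in
/-- Induction over the decomposition into simple objects. -/
theorem IsoClass.simple_induction (P : IsoClass C → Prop) (h0 : P 0)
    (hadd : ∀ s : IsoClass C, s ∈ Irr C → ∀ x, P x → P (s + x)) (x : IsoClass C) : P x := by
  obtain ⟨X, rfl⟩ := x.exists_rep
  obtain ⟨n, S, hS, ⟨e⟩⟩ := IsFusionCategory.semisimple k X
  rw [IsoClass.mk_eq e]
  clear e X
  induction n with
  | zero =>
    rw [IsoClass.mk_eq_zero_iff.2 (isZero_biproduct_of_isEmpty S)]
    exact h0
  | succ n ih =>
    rw [IsoClass.mk_eq (biproductSuccIso S), IsoClass.mk_biprod]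
    exact hadd _ ⟨S 0, hS 0, rfl⟩ _ (ih _ fun i => hS _)

include k in
lemma exists_exactPairing (X : C) : ∃ Y : C, Nonempty (ExactPairing X Y) := by
  obtain ⟨R⟩ := IsFusionCategory.rigid k (C := C)
  exact ⟨Xᘁ, ⟨inferInstance⟩⟩

variable (C) in
/-- The fusion data of a fusion category. -/
noncomputable def fusionData [IsAlgClosed k] : FusionData (IsoClass C) where
  simple := Irr C
  hom := Quotient.lift₂ (homDim k) fun _ _ _ _ ⟨e⟩ ⟨e'⟩ => homDim_congr k e e'
  finite := IsFusionCategory.finite_simples k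
  hom_add_left x y z := by
    have := IsFusionCategory.finite_hom (k := k) (C := C)
    obtain ⟨X, rfl⟩ := x.exists_rep
    obtain ⟨Y, rfl⟩ := y.exists_rep
    obtain ⟨Z, rfl⟩ := z.exists_rep
    exact homDim_biprod_left k X Y Z
  hom_add_right x y z := by
    have := IsFusionCategory.finite_hom (k := k) (C := C)
    obtain ⟨X, rfl⟩ := x.exists_rep
    obtain ⟨Y, rfl⟩ := y.exists_rep
    obtain ⟨Z, rfl⟩ := z.exists_rep
    exact homDim_biprod_right k X Y Z
  hom_self := by
    rintro _ ⟨X, hX, rfl⟩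
    have := IsFusionCategory.finite_hom (k := k) (C := C)
    exact finrank_endomorphism_simple_eq_one k X
  hom_ne := by
    rintro _ ⟨X, hX, rfl⟩ _ ⟨Y, hY, rfl⟩ hne
    exact finrank_hom_simple_simple_eq_zero_of_not_iso k
      fun e => hne (IsoClass.mk_eq e)
  one_mem := ⟨𝟙_ C, IsFusionCategory.simple_unit k, rfl⟩
  induction := IsoClass.simple_induction k
  exists_dual := by
    rintro _ ⟨X, hX, rfl⟩
    obtain ⟨R⟩ := IsFusionCategory.rigid k (C := C)
    refine ⟨IsoClass.mk (Xᘁ), fun a b => ?_⟩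
    obtain ⟨A, rfl⟩ := a.exists_rep
    obtain ⟨B, rfl⟩ := b.exists_rep
    exact ⟨(tensorRightHomLinearEquiv k A X (Xᘁ) B).finrank_eq,
      (tensorLeftHomLinearEquiv k A X (Xᘁ) B).finrank_eq⟩

variable [IsAlgClosed k]

lemma fusionData_hom_mk (X Y : C) :
    (fusionData k C).hom (IsoClass.mk X) (IsoClass.mk Y) = homDim k X Y := rfl

lemma mk_mem_simple_iff {X : C} : IsoClass.mk X ∈ (fusionData k C).simple ↔ Simple X := by
  constructor
  · rintro ⟨Y, hY, h⟩
    obtain ⟨e⟩ := IsoClass.mk_eq_mk.1 h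
    exact Simple.of_iso e.symm
  · exact fun h => ⟨X, h, rfl⟩

lemma isDual_of_exactPairing (X Y : C) [ExactPairing X Y] :
    (fusionData k C).IsDual (IsoClass.mk X) (IsoClass.mk Y) where
  mul_left a b := by
    obtain ⟨A, rfl⟩ := a.exists_rep
    obtain ⟨B, rfl⟩ := b.exists_rep
    exact (tensorRightHomLinearEquiv k A X Y B).finrank_eq
  left_mul a b := by
    obtain ⟨A, rfl⟩ := a.exists_rep
    obtain ⟨B, rfl⟩ := b.exists_rep
    exact (tensorLeftHomLinearEquiv k A X Y B).finrank_eq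

lemma isInvertible_iff {X : C} (hX : Simple X) {s : IsoClass C}
    (hd : (fusionData k C).IsDual (IsoClass.mk X) s) :
    IsInvertible X ↔ IsoClass.mk X * s = 1 := by
  have hs := (mk_mem_simple_iff k).2 hX
  constructor
  · rintro ⟨Y, ⟨p⟩, ⟨e⟩⟩
    rw [hd.unique (isDual_of_exactPairing k X Y) hs]
    exact IsoClass.mk_eq e
  · intro h
    obtain ⟨Y, ⟨p⟩⟩ := exists_exactPairing k X
    rw [hd.unique (isDual_of_exactPairing k X Y) hs] at h
    exact ⟨Y, ⟨p⟩, IsoClass.mk_eq_mk.1 h⟩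

end Fusion

section Dimension

variable {C : Type u} [Category.{v} C] [Abelian C] [MonoidalCategory C]

lemma isFPDimension_FPdim (h : ∃ d : C → ℝ, IsFPDimension d) :
    IsFPDimension (FPdim : C → ℝ) := by
  have : (FPdim : C → ℝ) = h.choose := by
    funext X
    rw [FPdim, dif_pos h]
  rw [this]
  exact h.choose_spec

variable [MonoidalPreadditive C]

/-- A dimension function induces a homomorphism on the Grothendieck semiring. -/
def IsFPDimension.ringHom {d : C → ℝ} (hd : IsFPDimension d) : IsoClass C →+* ℝ where
  toFun := Quotient.lift d fun _ _ ⟨e⟩ => hd.iso e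
  map_one' := hd.unit
  map_zero' := by
    change d 0 = 0
    have h1 := hd.add 0 0
    have h2 : d ((0 : C) ⊞ 0) = d 0 := hd.iso (isoZeroBiprod (isZero_zero C)).symm
    linarith
  map_add' x y := by
    obtain ⟨X, rfl⟩ := x.exists_rep
    obtain ⟨Y, rfl⟩ := y.exists_rep
    exact hd.add X Y
  map_mul' x y := by
    obtain ⟨X, rfl⟩ := x.exists_rep
    obtain ⟨Y, rfl⟩ := y.exists_rep
    exact hd.mul X Y

lemma IsFPDimension.one_le_ringHom {d : C → ℝ} (hd : IsFPDimension d) {x : IsoClass C}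
    (hx : x ≠ 0) : 1 ≤ hd.ringHom x := by
  obtain ⟨X, rfl⟩ := x.exists_rep
  exact hd.one_le X fun h => hx (IsoClass.mk_eq_zero_iff.2 h)

lemma isFPDimension_of_ringHom (d : IsoClass C →+* ℝ) (hd : ∀ x ≠ 0, 1 ≤ d x) :
    IsFPDimension fun X : C => d (IsoClass.mk X) where
  iso e := congrArg d (IsoClass.mk_eq e)
  add X Y := by rw [IsoClass.mk_biprod, map_add]
  unit := map_one d
  mul X Y := by rw [IsoClass.mk_tensor, map_mul]
  one_le X hX := hd _ fun h => hX (IsoClass.mk_eq_zero_iff.1 h)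

end Dimension

end FusionCat

namespace FusionData

variable {M : Type*} [Semiring M] {F : FusionData M} {χ : M}

lemma hom_le_one {s t : M} (hs : s ∈ F.simple) (ht : t ∈ F.simple) : F.hom s t ≤ 1 := by
  by_cases h : s = t
  · rw [h, F.hom_self t ht]
  · rw [F.hom_ne s hs t ht h]
    exact zero_le_one

lemma eq_one_or_of_hom {x : M} (hχ : χ ∈ F.simple) (hone : F.hom 1 x = 1)
    (hle : F.hom χ x ≤ 1) (h : ∀ u ∈ F.simple, F.hom u x ≠ 0 → u = 1 ∨ u = χ) :
    x = 1 ∨ x = 1 + χ := by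
  obtain ⟨y, rfl⟩ := exists_add_of_hom_ne_zero F.one_mem (by rw [hone]; exact one_ne_zero)
  rw [F.hom_add_right, F.hom_self 1 F.one_mem] at hone
  have key : ∀ s ∈ F.simple, ∀ z w, y = w + (s + z) → s = χ := by
    rintro s hs z w rfl
    have h1 := F.hom_self s hs
    refine (h s hs ?_).resolve_left ?_
    · simp only [F.hom_add_right]
      omega
    · rintro rfl
      simp only [F.hom_add_right] at hone
      omega
  rcases F.eq_zero_or y with rfl | ⟨s, hs, z, rfl⟩
  · exact Or.inl (add_zero 1)
  · right
    obtain rfl := key s hs z 0 (zero_add _).symm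
    rcases F.eq_zero_or z with rfl | ⟨t, ht, z', rfl⟩
    · rw [add_zero]
    · obtain rfl := key t ht z' s rfl
      have h1 := F.hom_self t ht
      simp only [F.hom_add_right] at hle
      omega

lemma isKernel_of_hom (mem : χ ∈ F.simple) (ne : χ ≠ 1) (hmul : χ * χ = 1)
    (h : ∀ s ∈ F.simple, ∀ s', F.IsDual s s' → ∀ u ∈ F.simple, F.hom u (s * s') ≠ 0 →
      u = 1 ∨ u = χ)
    (hne : ∃ s ∈ F.simple, ∃ s', F.IsDual s s' ∧ s * s' ≠ 1) : F.IsKernel χ := by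
  have key : ∀ s ∈ F.simple, ∀ s', F.IsDual s s' → s * s' = 1 ∨ s * s' = 1 + χ := by
    intro s hs s' hd
    refine eq_one_or_of_hom mem (by rw [hd.hom_one_mul, F.hom_self s hs]) ?_ (h s hs s' hd)
    rw [← hd.mul_left]
    exact hom_le_one ((isDual_self mem hmul).mul_mem_simple_left mem hmul hs) hs
  obtain ⟨s, hs, s', hd, h'⟩ := hne
  exact ⟨mem, ne, hmul, key, s, hs, s', hd, (key s hs s' hd).resolve_left h'⟩

end FusionData

namespace FusionCat

attribute [local instance] Abelian.hasFiniteBiproducts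

lemma finrank_map_of_fullyFaithful (k : Type w) [Field k] {C D : Type*} [Category* C]
    [Category* D] [Preadditive C] [Preadditive D] [Linear k C] [Linear k D] (F : C ⥤ D)
    [F.Full] [F.Faithful] [F.Additive] [F.Linear k] (X Y : C) :
    Module.finrank k (F.obj X ⟶ F.obj Y) = Module.finrank k (X ⟶ Y) :=
  (LinearEquiv.ofBijective (F.mapLinearMap k) ⟨F.map_injective, F.map_surjective⟩).finrank_eq.symm

namespace FaithfulGrading

section

variable {C : Type u} [Category.{v} C] [Abelian C] [MonoidalCategory C]
  {G : Type} [Group G] [Finite G] (𝒢 : FaithfulGrading C G)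

lemma exists_comp_of_simple (X : C) [Simple X] : ∃ g, 𝒢.comp g X := by
  obtain ⟨f, hf, ⟨e⟩⟩ := 𝒢.exists_decomp X
  have : ∃ g, e.hom ≫ biproduct.π f g ≠ 0 := by
    by_contra! h
    apply Simple.not_isZero X
    have h0 : e.hom = 0 := by
      ext g
      rw [h g, zero_comp]
    rw [IsZero.iff_id_eq_zero, ← e.hom_inv_id, h0, zero_comp]
  obtain ⟨g, hg⟩ := this
  have hne : biproduct.ι f g ≫ e.inv ≠ 0 := by
    intro h
    apply hg
    have : 𝟙 (f g) = 0 := by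
      rw [← biproduct.ι_π_self f g, ← e.inv_hom_id_assoc (biproduct.π f g), reassoc_of% h, zero_comp]
    rw [← Category.comp_id (e.hom ≫ biproduct.π f g), this, comp_zero]
  have := isIso_of_mono_of_nonzero hne
  exact ⟨g, 𝒢.comp_iso g (asIso (biproduct.ι f g ≫ e.inv)) (hf g)⟩

lemma eq_of_hom_ne_zero {g h : G} {X Y : C} (hX : 𝒢.comp g X) (hY : 𝒢.comp h Y) {f : X ⟶ Y}
    (hf : f ≠ 0) : g = h := by
  by_contra hne
  exact hf (𝒢.hom_eq_zero hne hX hY f)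

end

section

variable (k : Type w) [Field k] [IsAlgClosed k] {C : Type u} [Category.{v} C] [Abelian C]
  [Linear k C] [MonoidalCategory C] [MonoidalPreadditive C] [MonoidalLinear k C]
  [IsFusionCategory k C] {G : Type} [Group G] [Finite G] (𝒢 : FaithfulGrading C G)

include k in
lemma comp_one_of_hom_mul_dual {s s' : IsoClass C} (hs : s ∈ (fusionData k C).simple)
    (hd : (fusionData k C).IsDual s s') {U : C} [Simple U]
    (hU : (fusionData k C).hom (IsoClass.mk U) (s * s') ≠ 0) : 𝒢.comp 1 U := by
  have := IsFusionCategory.finite_hom (k := k) (C := C)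
  have hs' := hd.mem_simple hs
  have hone : (fusionData k C).hom 1 (s * s') ≠ 0 := by
    rw [hd.hom_one_mul, (fusionData k C).hom_self s hs]
    exact one_ne_zero
  obtain ⟨X, hX, rfl⟩ := hs
  obtain ⟨Y, hY, rfl⟩ := hs'
  obtain ⟨f, hf⟩ := homDim_ne_zero_iff.1 (show homDim k U (X ⊗ Y) ≠ 0 from hU)
  obtain ⟨f', hf'⟩ := homDim_ne_zero_iff.1 (show homDim k (𝟙_ C) (X ⊗ Y) ≠ 0 from hone)
  obtain ⟨g, hg⟩ := 𝒢.exists_comp_of_simple X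
  obtain ⟨h, hh⟩ := 𝒢.exists_comp_of_simple Y
  obtain ⟨i, hi⟩ := 𝒢.exists_comp_of_simple U
  have h1 := 𝒢.eq_of_hom_ne_zero 𝒢.unit_mem (𝒢.tensor_mem hg hh) hf'
  have h2 := 𝒢.eq_of_hom_ne_zero hi (𝒢.tensor_mem hg hh) hf
  rwa [h2, ← h1] at hi

end

end FaithfulGrading

section

variable {k : Type w} [Field k] [IsAlgClosed k] {C : Type u} [Category.{v} C] [Abelian C]
  [Linear k C] [MonoidalCategory C] [MonoidalPreadditive C] [MonoidalLinear k C]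
  [IsFusionCategory k C]

lemma exists_isKernel_of_isExtension (hC : ¬ IsPointed C)
    (h : IsExtensionOfRankTwoPointed k C) : ∃ χ, (fusionData k C).IsKernel χ := by
  obtain ⟨D, _, _, _, _, _, _, _, hpt, hrank, G, _, _, 𝒢, Φ, _, _, _, ⟨_⟩⟩ := h
  have hdim (X Y : 𝒢.TrivialComponent) :
      (fusionData k D).hom (IsoClass.mk (Φ.obj X)) (IsoClass.mk (Φ.obj Y)) =
        (fusionData k C).hom (IsoClass.mk X.obj) (IsoClass.mk Y.obj) :=
    (finrank_map_of_fullyFaithful k Φ X Y).trans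
      (finrank_map_of_fullyFaithful k 𝒢.trivialProp.ι X Y).symm
  have hsimple (X : 𝒢.TrivialComponent) :
      Simple (Φ.obj X) ↔ Simple X.obj := by
    rw [← mk_mem_simple_iff k, ← mk_mem_simple_iff k]
    constructor
    · intro h
      apply FusionData.mem_simple_of_hom_self
      rw [← hdim]
      exact (fusionData k D).hom_self _ h
    · intro h
      apply FusionData.mem_simple_of_hom_self
      rw [hdim]
      exact (fusionData k C).hom_self _ h
  have hiso (X Y : 𝒢.TrivialComponent)
      (h : IsoClass.mk (Φ.obj X) = IsoClass.mk (Φ.obj Y)) :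
      IsoClass.mk X.obj = IsoClass.mk Y.obj := by
    obtain ⟨e⟩ := IsoClass.mk_eq_mk.1 h
    exact IsoClass.mk_eq (𝒢.trivialProp.ι.mapIso (Φ.preimageIso e))
  have hunit : IsoClass.mk (Φ.obj (𝟙_ _)) = 1 := IsoClass.mk_eq (Functor.Monoidal.εIso Φ).symm
  have hpre (X : D) : ∃ Y : 𝒢.TrivialComponent, IsoClass.mk (Φ.obj Y) = IsoClass.mk X :=
    ⟨Φ.objPreimage X, IsoClass.mk_eq (Φ.objObjPreimageIso X)⟩
  obtain ⟨b, hb, hbne, hall⟩ : ∃ b ∈ (fusionData k D).simple, b ≠ 1 ∧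
      ∀ x ∈ (fusionData k D).simple, x = 1 ∨ x = b := by
    have hone := (fusionData k D).one_mem
    obtain ⟨x, y, hxy, hIrr⟩ := Set.ncard_eq_two.1 hrank
    have hmem (z : IsoClass D) : z ∈ (fusionData k D).simple ↔ z = x ∨ z = y := by
      change z ∈ Irr D ↔ _
      rw [hIrr]
      rfl
    rcases (hmem 1).1 hone with h | h
    · refine ⟨y, (hmem y).2 (Or.inr rfl), ?_, fun z hz => ?_⟩
      · rw [h]
        exact Ne.symm hxy
      · rw [h]
        exact (hmem z).1 hz
    · refine ⟨x, (hmem x).2 (Or.inl rfl), ?_, fun z hz => ?_⟩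
      · rw [h]
        exact hxy
      · rw [h]
        exact ((hmem z).1 hz).symm
  obtain ⟨B, hB, rfl⟩ := hb
  change IsoClass.mk B ≠ 1 at hbne
  obtain ⟨X, hX⟩ := hpre B
  have hXs : Simple X.obj := by
    rw [← hsimple, ← mk_mem_simple_iff k, hX, mk_mem_simple_iff]
    exact hB
  have hcases (U : 𝒢.TrivialComponent) (hU : Simple U.obj) :
      IsoClass.mk U.obj = 1 ∨ IsoClass.mk U.obj = IsoClass.mk X.obj := by
    rcases hall _ ((mk_mem_simple_iff k).2 ((hsimple U).2 hU)) with h | h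
    · exact Or.inl (hiso U (𝟙_ _) (h.trans hunit.symm))
    · exact Or.inr (hiso U X (h.trans hX.symm))
  have hXne : IsoClass.mk X.obj ≠ 1 := by
    intro h
    obtain ⟨e⟩ := IsoClass.mk_eq_mk.1 (show _ = IsoClass.mk (𝟙_ C) from h)
    apply hbne
    rw [← hX, ← hunit]
    exact IsoClass.mk_eq (Φ.mapIso (𝒢.trivialProp.ι.preimageIso (Y := 𝟙_ _) e))
  have hXX : IsoClass.mk X.obj * IsoClass.mk X.obj = 1 := by
    obtain ⟨Y, ⟨p⟩, ⟨e⟩⟩ := hpt B hB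
    have hY : Simple Y := (mk_mem_simple_iff k).1
      ((isDual_of_exactPairing k B Y).mem_simple ((mk_mem_simple_iff k).2 hB))
    obtain ⟨Z, hZ⟩ := hpre Y
    have hZs : Simple Z.obj := by
      rw [← hsimple, ← mk_mem_simple_iff k, hZ, mk_mem_simple_iff]
      exact hY
    have hXZ : IsoClass.mk X.obj * IsoClass.mk Z.obj = 1 := by
      refine hiso (X ⊗ Z) (𝟙_ _) ?_
      rw [hunit, ← IsoClass.mk_eq (Functor.Monoidal.μIso Φ X Z), IsoClass.mk_tensor, hX, hZ]
      exact IsoClass.mk_eq e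
    rcases hcases Z hZs with h | h
    · rw [h, mul_one] at hXZ
      exact absurd hXZ hXne
    · rwa [h] at hXZ
  refine ⟨IsoClass.mk X.obj, FusionData.isKernel_of_hom ((mk_mem_simple_iff k).2 hXs) hXne hXX
    ?_ ?_⟩
  · rintro s hs s' hd _ ⟨U, hU, rfl⟩ hne
    exact hcases ⟨U, 𝒢.comp_one_of_hom_mul_dual k hs hd hne⟩ hU
  · rw [IsPointed] at hC
    push Not at hC
    obtain ⟨U, hU, hinv⟩ := hC
    have hUs := (mk_mem_simple_iff k).2 hU
    obtain ⟨s', hd⟩ := FusionData.exists_isDual hUs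
    exact ⟨_, hUs, s', hd, fun h => hinv ((isInvertible_iff k hU hd).2 h)⟩

lemma cd_eq_of_isKernel {χ : IsoClass C} (K : (fusionData k C).IsKernel χ) :
    cd C = {1, Real.sqrt 2} := by
  have hFP : IsFPDimension (FPdim : C → ℝ) :=
    isFPDimension_FPdim ⟨_, isFPDimension_of_ringHom K.dim fun x hx => K.one_le_dim hx⟩
  have hval (X : C) (hX : Simple X) : FPdim X = FusionData.weight χ (IsoClass.mk X) :=
    K.map_simple hFP.ringHom (fun x hx => hFP.one_le_ringHom hx) ((mk_mem_simple_iff k).2 hX)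
  apply Set.Subset.antisymm
  · rintro _ ⟨X, hX, rfl⟩
    rw [hval X hX, FusionData.weight]
    split_ifs
    · exact Or.inr rfl
    · exact Or.inl rfl
  · rintro _ (rfl | rfl)
    · exact ⟨𝟙_ C, IsFusionCategory.simple_unit k, hFP.unit⟩
    · obtain ⟨_, hs, s', hd, h⟩ := K.exists_ne
      have hχ := K.chi_mul_eq_self hd hs h
      obtain ⟨X, hX, rfl⟩ := hs
      exact ⟨X, hX, (hval X hX).trans (FusionData.weight_of_eq hχ)⟩

lemma exists_isKernel_of_cd_eq (h : cd C = {1, Real.sqrt 2}) :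
    ∃ χ, (fusionData k C).IsKernel χ := by
  have hex : ∃ d : C → ℝ, IsFPDimension d := by
    by_contra hcon
    obtain ⟨X, -, hX⟩ : (1 : ℝ) ∈ cd C := by
      rw [h]
      exact Or.inl rfl
    rw [FPdim, dif_neg hcon] at hX
    exact zero_ne_one hX
  have hFP := isFPDimension_FPdim hex
  obtain ⟨X, hX, hX2⟩ : Real.sqrt 2 ∈ cd C := by
    rw [h]
    exact Or.inr rfl
  refine FusionData.exists_isKernel_of_values (d := hFP.ringHom) ?_
    ((mk_mem_simple_iff k).2 hX) hX2
  rintro _ ⟨Y, hY, rfl⟩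
  have : FPdim Y ∈ cd C := ⟨Y, hY, rfl⟩
  rwa [h] at this

end

end FusionCat

namespace FusionData

variable {M : Type*} [Semiring M] {F : FusionData M}

lemma exists_hom_mul_ne_zero {u x y : M} (h : F.hom u (x * y) ≠ 0) :
    ∃ s ∈ F.simple, ∃ t ∈ F.simple, F.hom s x ≠ 0 ∧ F.hom t y ≠ 0 ∧ F.hom u (s * t) ≠ 0 := by
  revert h
  refine F.induction (fun x => F.hom u (x * y) ≠ 0 → ∃ s ∈ F.simple, ∃ t ∈ F.simple,
    F.hom s x ≠ 0 ∧ F.hom t y ≠ 0 ∧ F.hom u (s * t) ≠ 0) ?_ ?_ x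
  · intro h
    rw [zero_mul, hom_zero_right] at h
    exact absurd rfl h
  · intro s hs x hx h
    by_cases h1 : F.hom u (x * y) = 0
    · rw [add_mul, F.hom_add_right, h1, add_zero] at h
      revert h
      refine F.induction (fun y => F.hom u (s * y) ≠ 0 → ∃ s' ∈ F.simple, ∃ t ∈ F.simple,
        F.hom s' (s + x) ≠ 0 ∧ F.hom t y ≠ 0 ∧ F.hom u (s' * t) ≠ 0) ?_ ?_ y
      · intro h
        rw [mul_zero, hom_zero_right] at h
        exact absurd rfl h
      · intro t ht y hy h
        by_cases h2 : F.hom u (s * y) = 0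
        · rw [mul_add, F.hom_add_right, h2, add_zero] at h
          refine ⟨s, hs, t, ht, ?_, ?_, h⟩
          · rw [F.hom_add_right, F.hom_self s hs]
            omega
          · rw [F.hom_add_right, F.hom_self t ht]
            omega
        · obtain ⟨s', hs', t', ht', h3, h4, h5⟩ := hy h2
          refine ⟨s', hs', t', ht', h3, ?_, h5⟩
          rw [F.hom_add_right]
          omega
    · obtain ⟨s', hs', t', ht', h3, h4, h5⟩ := hx h1
      refine ⟨s', hs', t', ht', ?_, h4, h5⟩
      rw [F.hom_add_right]
      omega

end FusionData

namespace FusionCat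

open scoped ZeroObject

attribute [local instance] Abelian.hasFiniteBiproducts

section

variable {k : Type w} [Field k] {C : Type u} [Category.{v} C] [Abelian C]
  [Linear k C] [MonoidalCategory C] [MonoidalPreadditive C] [MonoidalLinear k C]
  [IsFusionCategory k C]

include k in
lemma exists_simple_comp_ne_zero {X Y : C} {f : X ⟶ Y} (hf : f ≠ 0) :
    ∃ (S : C) (_ : Simple S) (g : S ⟶ X), g ≫ f ≠ 0 := by
  obtain ⟨n, S, hS, ⟨e⟩⟩ := IsFusionCategory.semisimple k X
  by_contra! h
  apply hf
  rw [← cancel_epi e.inv, comp_zero]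
  ext i
  rw [comp_zero, ← Category.assoc]
  exact h (S i) (hS i) _

variable [IsAlgClosed k] {G : Type} (c : (fusionData k C).simple → G)

/-- The objects all of whose simple constituents have degree `g`. -/
def homogeneous (g : G) : ObjectProperty C := fun X =>
  ∀ s : (fusionData k C).simple, (fusionData k C).hom s.1 (IsoClass.mk X) ≠ 0 → c s = g

variable {c}

lemma homogeneous_iff {g : G} {X : C} :
    homogeneous c g X ↔ ∀ (S : C) (hS : Simple S) (f : S ⟶ X), f ≠ 0 →
      c ⟨IsoClass.mk S, (mk_mem_simple_iff k).2 hS⟩ = g := by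
  have := IsFusionCategory.finite_hom (k := k) (C := C)
  constructor
  · intro h S hS f hf
    refine h _ ?_
    rw [fusionData_hom_mk, homDim_ne_zero_iff]
    exact ⟨f, hf⟩
  · rintro h ⟨_, S, hS, rfl⟩ hne
    obtain ⟨f, hf⟩ := homDim_ne_zero_iff.1 (show homDim k S X ≠ 0 from hne)
    exact h S hS f hf

lemma homogeneous_of_mono {g : G} {X Y : C} (f : X ⟶ Y) [Mono f] (h : homogeneous c g Y) :
    homogeneous c g X := by
  rw [homogeneous_iff] at h ⊢
  intro S hS p hp
  refine h S hS (p ≫ f) fun h0 => hp ?_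
  rwa [← cancel_mono f, zero_comp]

lemma homogeneous_of_epi {g : G} {X Y : C} (f : X ⟶ Y) [Epi f] (h : homogeneous c g X) :
    homogeneous c g Y := by
  have := IsFusionCategory.finite_hom (k := k) (C := C)
  rintro ⟨_, S, hS, rfl⟩ hne
  apply h
  rw [(fusionData k C).hom_comm] at hne ⊢
  obtain ⟨p, hp⟩ := homDim_ne_zero_iff.1 (show homDim k Y S ≠ 0 from hne)
  exact homDim_ne_zero_iff.2 ⟨f ≫ p, fun h0 => hp (by rwa [← cancel_epi f, comp_zero])⟩

lemma homogeneous_iso {g : G} {X Y : C} (e : X ≅ Y) (h : homogeneous c g X) :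
    homogeneous c g Y :=
  homogeneous_of_mono e.inv h

lemma homogeneous_simple {S : C} (hS : Simple S) :
    homogeneous c (c ⟨IsoClass.mk S, (mk_mem_simple_iff k).2 hS⟩) S := by
  intro t h
  congr 1
  exact Subtype.ext (FusionData.eq_of_hom_ne_zero t.2 ((mk_mem_simple_iff k).2 hS) h)

lemma homogeneous_biproduct {g : G} {J : Type} [Finite J] {S : J → C}
    (h : ∀ j, homogeneous c g (S j)) : homogeneous c g (⨁ S) := by
  rw [homogeneous_iff]
  intro T hT f hf
  by_contra hne
  apply hf
  ext j
  rw [zero_comp]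
  by_contra hj
  exact hne (homogeneous_iff.1 (h j) T hT _ hj)

/-- A grading of the simple objects extends to a grading of the category. -/
noncomputable def gradingOfSimple [Group G] [Finite G]
    (hmul : ∀ s t u : (fusionData k C).simple, (fusionData k C).hom u.1 (s.1 * t.1) ≠ 0 →
      c u = c s * c t)
    (hsurj : Function.Surjective c)
    (hone : c ⟨1, (fusionData k C).one_mem⟩ = 1) : FaithfulGrading C G where
  comp := homogeneous c
  comp_iso _ _ _ e h := homogeneous_iso e h
  exists_decomp X := by
    obtain ⟨n, S, hS, ⟨e⟩⟩ := IsFusionCategory.semisimple k X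
    let deg (i : Fin n) : G := c ⟨IsoClass.mk (S i), (mk_mem_simple_iff k).2 (hS i)⟩
    refine ⟨fun g => ⨁ fun i : {i // deg i = g} => S i.1, fun g => ?_, ⟨?_⟩⟩
    · refine homogeneous_biproduct fun i => ?_
      obtain ⟨i, rfl⟩ := i
      exact homogeneous_simple (hS i)
    · refine e ≪≫ ?_ ≪≫ (biproductBiproductIso (fun g => {i // deg i = g})
        fun _ i => S i.1).symm
      exact biproduct.whiskerEquiv (Equiv.sigmaFiberEquiv deg).symm fun i => Iso.refl (S i)
  hom_eq_zero := by
    intro g h hgh X Y hX hY f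
    by_contra hf
    obtain ⟨S, hS, p, hp⟩ := exists_simple_comp_ne_zero (k := k) hf
    apply hgh
    rw [← homogeneous_iff.1 hX S hS p (fun h0 => hp (by rw [h0, zero_comp])),
      homogeneous_iff.1 hY S hS _ hp]
  tensor_mem := by
    intro g h X Y hX hY u hu
    rw [IsoClass.mk_tensor] at hu
    obtain ⟨s, hs, t, ht, hsX, htY, hst⟩ := FusionData.exists_hom_mul_ne_zero hu
    rw [hmul ⟨s, hs⟩ ⟨t, ht⟩ u hst, hX ⟨s, hs⟩ hsX, hY ⟨t, ht⟩ htY]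
  unit_mem := by
    rw [← hone]
    exact homogeneous_simple (IsFusionCategory.simple_unit k)
  faithful g := by
    obtain ⟨⟨_, S, hS, rfl⟩, rfl⟩ := hsurj g
    exact ⟨S, homogeneous_simple hS, Simple.not_isZero S⟩

lemma homogeneous_one_dual [Group G]
    (hmul : ∀ s t u : (fusionData k C).simple, (fusionData k C).hom u.1 (s.1 * t.1) ≠ 0 →
      c u = c s * c t)
    (hone : c ⟨1, (fusionData k C).one_mem⟩ = 1) {X Y : C}
    (hd : (fusionData k C).IsDual (IsoClass.mk X) (IsoClass.mk Y)) (hX : homogeneous c 1 X) :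
    homogeneous c 1 Y := by
  intro s hs
  rw [← one_mul (IsoClass.mk Y), ← hd.mul_left, (fusionData k C).hom_comm] at hs
  obtain ⟨s', hs', t, ht, hss', htX, h1⟩ := FusionData.exists_hom_mul_ne_zero hs
  obtain rfl := FusionData.eq_of_hom_ne_zero hs' s.2 hss'
  have h2 := hmul ⟨s.1, hs'⟩ ⟨t, ht⟩ ⟨1, (fusionData k C).one_mem⟩ h1
  rw [hone, hX ⟨t, ht⟩ htX, mul_one] at h2
  exact h2.symm

end

section

variable {k : Type w} [Field k] [IsAlgClosed k] {C : Type u} [Category.{v} C] [Abelian C]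
  [Linear k C] [MonoidalCategory C] [MonoidalPreadditive C] [MonoidalLinear k C]
  [IsFusionCategory k C] {G : Type} {c : (fusionData k C).simple → G}

instance (g : G) : (homogeneous c g).IsClosedUnderSubobjects where
  prop_of_mono f _ h := homogeneous_of_mono f h

instance (g : G) : (homogeneous c g).IsClosedUnderQuotients where
  prop_of_epi f _ h := homogeneous_of_epi f h

instance (g : G) : (homogeneous c g).ContainsZero where
  exists_zero := ⟨0, isZero_zero C, by
    rw [homogeneous_iff]
    intro S hS f hf
    exact absurd ((isZero_zero C).eq_zero_of_tgt f) hf⟩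

instance (g : G) : (homogeneous c g).IsClosedUnderFiniteProducts where
  isClosedUnderLimitsOfShape J _ := ⟨by
    rintro X ⟨h⟩
    rw [homogeneous_iff]
    intro S hS f hf
    by_contra hne
    refine hf (h.isLimit.hom_ext fun j => ?_)
    rw [zero_comp]
    by_contra hj
    exact hne (homogeneous_iff.1 (h.prop_diag_obj j) S hS _ hj)⟩

end

section FullSubcategory

lemma nonempty_iso_fullSubcategory {C : Type u} [Category.{v} C] {P : ObjectProperty C}
    {X Y : P.FullSubcategory} (e : X.obj ≅ Y.obj) : Nonempty (X ≅ Y) :=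
  ⟨P.ι.preimageIso e⟩

lemma simple_fullSubcategory {C : Type u} [Category.{v} C] [Abelian C] {P : ObjectProperty C}
    [P.IsClosedUnderSubobjects] [P.IsClosedUnderQuotients] [P.ContainsZero]
    {X : P.FullSubcategory} (h : Simple X.obj) : Simple X where
  mono_isIso_iff_nonzero {Y} f _ := by
    have := P.preservesMonomorphisms_ι_of_isNormalEpiCategory
    have hf : Mono (P.ι.map f) := inferInstance
    rw [← isIso_iff_of_reflects_iso f P.ι]
    exact (h.mono_isIso_iff_nonzero (P.ι.map f)).trans (not_congr P.ι.map_eq_zero_iff)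

lemma simple_obj_of_simple (k : Type w) [Field k] {C : Type u} [Category.{v} C] [Abelian C]
    [Linear k C] [MonoidalCategory C] [MonoidalPreadditive C] [MonoidalLinear k C]
    [IsFusionCategory k C] {P : ObjectProperty C} [P.IsClosedUnderSubobjects]
    {X : P.FullSubcategory} (h : Simple X) : Simple X.obj := by
  have hne : 𝟙 X.obj ≠ 0 := fun h0 => id_nonzero X (P.ι.map_injective (by simpa using h0))
  obtain ⟨S, hS, g, hg⟩ := exists_simple_comp_ne_zero (k := k) hne
  rw [Category.comp_id] at hg
  have hm : Mono g := mono_of_nonzero_from_simple hg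
  let S' : P.FullSubcategory := ⟨S, P.prop_of_mono g X.property⟩
  let g' : S' ⟶ X := P.homMk g
  have hm' : Mono g' := P.ι.mono_of_mono_map hm
  have hg' : g' ≠ 0 := fun h0 => hg (congrArg (fun f => f.hom) h0)
  have := isIso_of_mono_of_nonzero hg'
  have : IsIso g := inferInstanceAs (IsIso (P.ι.map g'))
  exact Simple.of_iso (asIso g).symm

variable {C : Type u} [Category.{v} C] [MonoidalCategory C]
  (P : ObjectProperty C) [P.IsMonoidal]

lemma exactPairing_fullSubcategory (X Y : P.FullSubcategory) (p : ExactPairing X.obj Y.obj) :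
    Nonempty (ExactPairing X Y) :=
  letI : ExactPairing (P.ι.obj X) (P.ι.obj Y) := p
  ⟨ExactPairing.ofFullyFaithful P.ι X Y⟩

lemma rigid_fullSubcategory [RigidCategory C]
    (hdual : ∀ X Y : C, ExactPairing X Y → (P X ↔ P Y)) :
    Nonempty (RigidCategory P.FullSubcategory) :=
  ⟨{  rightDual X :=
        let Y : P.FullSubcategory := ⟨X.objᘁ, (hdual X.obj (X.objᘁ) inferInstance).1 X.property⟩
        { rightDual := Y
          exact := (exactPairing_fullSubcategory P X Y inferInstance).some }
      leftDual X :=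
        let Y : P.FullSubcategory := ⟨ᘁX.obj, (hdual (ᘁX.obj) X.obj inferInstance).2 X.property⟩
        { leftDual := Y
          exact := (exactPairing_fullSubcategory P Y X inferInstance).some } }⟩

variable {P} [Abelian C] [P.IsClosedUnderSubobjects] [P.IsClosedUnderQuotients] [P.ContainsZero]
  [P.IsClosedUnderFiniteProducts]

variable (k : Type w) [Field k] [Linear k C] [MonoidalPreadditive C] [MonoidalLinear k C]
  [IsFusionCategory k C]

/-- A full subcategory closed under subobjects, quotients, sums, tensor products and duals is a
fusion category. -/
theorem isFusionCategory_fullSubcategory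
    (hdual : ∀ X Y : C, ExactPairing X Y → (P X ↔ P Y)) :
    IsFusionCategory k P.FullSubcategory where
  semisimple X := by
    obtain ⟨n, S, hS, ⟨e⟩⟩ := IsFusionCategory.semisimple k X.obj
    let T (i : Fin n) : P.FullSubcategory :=
      ⟨S i, P.prop_of_mono (biproduct.ι S i ≫ e.inv) X.property⟩
    refine ⟨n, T, fun i => simple_fullSubcategory (hS i), ?_⟩
    exact nonempty_iso_fullSubcategory (e ≪≫ (P.ι.mapBiproduct T).symm)
  rigid := by
    obtain ⟨_⟩ := IsFusionCategory.rigid k (C := C)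
    exact rigid_fullSubcategory P hdual
  finite_simples := by
    have hmap : ∀ X Y : P.FullSubcategory, (isIsomorphicSetoid _).r X Y →
        (isIsomorphicSetoid C).r X.obj Y.obj := fun X Y ⟨e⟩ => ⟨P.ι.mapIso e⟩
    refine Set.Finite.of_injOn (f := Quotient.map (fun X : P.FullSubcategory => X.obj) hmap)
      ?_ ?_ (IsFusionCategory.finite_simples k (C := C))
    · rintro _ ⟨X, hX, rfl⟩
      exact ⟨X.obj, simple_obj_of_simple k hX, rfl⟩
    · rintro _ ⟨X, hX, rfl⟩ _ ⟨Y, hY, rfl⟩ h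
      obtain ⟨e⟩ := Quotient.exact h
      exact Quotient.sound (nonempty_iso_fullSubcategory e)
  finite_hom X Y := by
    have := IsFusionCategory.finite_hom (k := k) X.obj Y.obj
    exact Module.Finite.equiv (InducedCategory.homLinearEquiv (R := k) (F := fun Z : P.FullSubcategory => Z.obj)).symm
  simple_unit := simple_fullSubcategory (IsFusionCategory.simple_unit k)

end FullSubcategory

lemma isExtension_of_trivialComponent {k : Type w} [Field k] {C : Type u} [Category.{v} C]
    [Abelian C] [Linear k C] [MonoidalCategory C] [MonoidalPreadditive C] [MonoidalLinear k C]
    {G : Type} [Group G] [Finite G] (𝒢 : FaithfulGrading C G)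
    [𝒢.trivialProp.IsClosedUnderSubobjects] [𝒢.trivialProp.IsClosedUnderQuotients]
    [𝒢.trivialProp.ContainsZero] [𝒢.trivialProp.IsClosedUnderFiniteProducts]
    (hfus : IsFusionCategory k 𝒢.TrivialComponent) (hpt : IsPointed 𝒢.TrivialComponent)
    (hrank : rank 𝒢.TrivialComponent = 2) : IsExtensionOfRankTwoPointed k C :=
  ⟨𝒢.TrivialComponent, inferInstance, inferInstance, inferInstance, inferInstance,
    inferInstance, inferInstance, hfus, hpt, hrank, G, inferInstance, inferInstance, 𝒢,
    𝟭 _, inferInstance, inferInstance, inferInstance, ⟨inferInstance⟩⟩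

section

variable {k : Type w} [Field k] [IsAlgClosed k] {C : Type u} [Category.{v} C] [Abelian C]
  [Linear k C] [MonoidalCategory C] [MonoidalPreadditive C] [MonoidalLinear k C]
  [IsFusionCategory k C]

lemma isExtension_of_isKernel {χ : IsoClass C} (K : (fusionData k C).IsKernel χ) :
    IsExtensionOfRankTwoPointed k C := by
  obtain ⟨G, _, _, c, hmul, hsurj, hone⟩ := K.exists_grading
  have hc1 := (hone ⟨1, (fusionData k C).one_mem⟩).2 (Or.inl rfl)
  let 𝒢 := gradingOfSimple hmul hsurj hc1
  let P : ObjectProperty C := homogeneous c 1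
  have : P.IsMonoidal := inferInstanceAs 𝒢.trivialProp.IsMonoidal
  have hdual (X Y : C) (p : ExactPairing X Y) : P X ↔ P Y :=
    ⟨homogeneous_one_dual hmul hc1 (isDual_of_exactPairing k X Y),
      homogeneous_one_dual hmul hc1 (isDual_of_exactPairing k X Y).symm⟩
  have hfus := isFusionCategory_fullSubcategory k hdual
  obtain ⟨X, hX, rfl⟩ := K.mem
  change (fusionData k C).IsKernel (IsoClass.mk X) at K
  have hXs := (mk_mem_simple_iff k).2 hX
  have hPX : P X := by
    have := homogeneous_simple (c := c) hX
    rwa [(hone ⟨IsoClass.mk X, hXs⟩).2 (Or.inr rfl)] at this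
  have hcases (Y : P.FullSubcategory) (hY : Simple Y) :
      Simple Y.obj ∧ (IsoClass.mk Y.obj = 1 ∨ IsoClass.mk Y.obj = IsoClass.mk X) := by
    have hY' := simple_obj_of_simple k hY
    refine ⟨hY', ?_⟩
    have hYs := (mk_mem_simple_iff k).2 hY'
    refine (hone ⟨IsoClass.mk Y.obj, hYs⟩).1 (Y.property _ ?_)
    rw [(fusionData k C).hom_self _ hYs]
    exact one_ne_zero
  have : 𝒢.trivialProp.IsClosedUnderSubobjects := inferInstanceAs P.IsClosedUnderSubobjects
  have : 𝒢.trivialProp.IsClosedUnderQuotients := inferInstanceAs P.IsClosedUnderQuotients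
  have : 𝒢.trivialProp.ContainsZero := inferInstanceAs P.ContainsZero
  have : 𝒢.trivialProp.IsClosedUnderFiniteProducts :=
    inferInstanceAs P.IsClosedUnderFiniteProducts
  refine isExtension_of_trivialComponent 𝒢 hfus ?_ ?_
  · intro Y hY
    obtain ⟨hY', h⟩ := hcases Y hY
    have hinv : IsInvertible Y.obj := by
      have hYs := (mk_mem_simple_iff k).2 hY'
      have hYY : IsoClass.mk Y.obj * IsoClass.mk Y.obj = 1 := by
        rcases h with h | h <;> rw [h]
        · exact one_mul 1
        · exact K.mul_self
      exact (isInvertible_iff k hY' (FusionData.isDual_self hYs hYY)).2 hYY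
    obtain ⟨Z, ⟨p⟩, ⟨e⟩⟩ := hinv
    let Z' : P.FullSubcategory := ⟨Z, (hdual _ _ p).1 Y.property⟩
    exact ⟨Z', exactPairing_fullSubcategory P Y Z' p,
      nonempty_iso_fullSubcategory (X := Y ⊗ Z') (Y := 𝟙_ _) e⟩
  · let X' : P.FullSubcategory := ⟨X, hPX⟩
    have hIrr : Irr P.FullSubcategory = {IsoClass.mk (𝟙_ P.FullSubcategory), IsoClass.mk X'} := by
      apply Set.Subset.antisymm
      · rintro _ ⟨Y, hY, rfl⟩
        rcases (hcases Y hY).2 with h | h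
        · obtain ⟨e⟩ := IsoClass.mk_eq_mk.1 (show _ = IsoClass.mk (𝟙_ C) from h)
          exact Or.inl (Quotient.sound (nonempty_iso_fullSubcategory (Y := 𝟙_ _) e))
        · obtain ⟨e⟩ := IsoClass.mk_eq_mk.1 h
          exact Or.inr (Quotient.sound (nonempty_iso_fullSubcategory (Y := X') e))
      · rintro _ (rfl | rfl)
        · exact ⟨_, hfus.simple_unit, rfl⟩
        · exact ⟨X', simple_fullSubcategory hX, rfl⟩
    refine (congrArg Set.ncard hIrr).trans (Set.ncard_pair fun h => K.ne_one ?_)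
    obtain ⟨e⟩ := IsoClass.mk_eq_mk.1 h
    exact (IsoClass.mk_eq (P.ι.mapIso e)).symm

end

end FusionCat

theorem corollary3p2 {k : Type w} [Field k] [IsAlgClosed k] [CharZero k]
    {C : Type u} [Category.{v} C] [Abelian C] [Linear k C] [MonoidalCategory C]
    [MonoidalPreadditive C] [MonoidalLinear k C] [FusionCat.IsFusionCategory k C]
    (hC : ¬ FusionCat.IsPointed C) :
    FusionCat.IsExtensionOfRankTwoPointed k C ↔ FusionCat.cd C = {1, Real.sqrt 2} := by
  constructor
  · intro h
    obtain ⟨χ, K⟩ := FusionCat.exists_isKernel_of_isExtension hC h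
    exact FusionCat.cd_eq_of_isKernel K
  · intro h
    obtain ⟨χ, K⟩ := FusionCat.exists_isKernel_of_cd_eq (k := k) h
    exact FusionCat.isExtension_of_isKernel K
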